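/- Let $n>1$ and $\lambda>0$. Let $\mathbb A^{(\lambda)}(\mathbb D^n)$ be the reproducing kernel Hilbert space of (holomorphic) functions on $\mathbb D^n$ with kernel $K^{(\lambda)}(\boldsymbol z,\boldsymbol w)=\prod_{j=1}^n(1-z_j\bar w_j)^{-\lambda}$, and let $\mathbb A^{(\lambda)}_{\rm sym}(\mathbb D^n)$ and $\mathbb A^{(\lambda)}_{\rm anti}(\mathbb D^n)$ be its closed subspaces of functions with $f\circ\sigma^{-1}=f$, respectively $f\circ\sigma^{-1}={\rm sgn}(\sigma)f$, for all permutations $\sigma$ of the $n$ coordinates. Let $s_k$ be the elementary symmetric polynomial of degree $k$ in $n$ variables. A directed graph $G=(V,E)$ without loops, $V\neq\emptyset$, is a generalized directed semi-tree $(G,m)$ if it has no circuit (no distinct vertices $v_1,\dots,v_l$, $l\ge 2$, with edges $(v_j,v_{j+1})$ and $(v_l,v_1)$), has countably many connected components, and $m$ is the least non-negative integer with ${\rm card}({\rm Chi}(u)\cap{\rm Chi}(v))\le m$ for all distinct $u,v\in V$, where ${\rm Chi}(u)=\{v:(u,v)\in E\}$ and ${\rm Par}(v)=\{u:(u,v)\in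 E\}$. For weights $\lambda_{(u,v)}\in\mathbb C$ on the edges with $\sum_{u\in{\rm Par}(v)}|\lambda_{(u,v)}|^2<\infty$ for every $v$, the weighted shift on $G$ is the operator $f\mapsto\big(v\mapsto\sum_{u\in{\rm Par}(v)}\lambda_{(u,v)}f(u)\big)$ in $\ell^2(V)$ with domain all $f\in\ell^2(V)$ whose image is in $\ell^2(V)$. We write $\chi_u$ for the standard basis vectors of $\ell^2(V)$. Let $\mathcal P^{\rm(sym)}_n$ be the set of all $\boldsymbol u\in\mathbb N_0^n$ with $u_1\ge\dots\ge u_n$, and $\mathcal P^{\rm(anti)}_n=\{\boldsymbol v+(n-1,\dots,1,0):\boldsymbol v\in\mathcal P^{\rm(sym)}_n\}$. For $1\le k\le n$ let $\mathcal I^{(k)}_{\boldsymbol u}$ be the set of $\boldsymbol v\in\mathcal P_n^{\rm(sym)}$ with $0\le v_j-u_j\le1$ for all $j$ and $\sum_j(v_j-u_j)=k$. Let $G^{(k)}_{\rm sym}$ and $G^{(k)}_{\rm anti}$ be the directed graphs with vertex sets $\mathcal P_n^{\rm(sym)}$ and $\mathcal P_n^{\rm(anti)}$, in which $(\boldsymbol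 u,\boldsymbol v)$ is an edge iff $\boldsymbol v\in\mathcal I^{(k)}_{\boldsymbol u}$. Let $m_{\boldsymbol u}$ be the monomial symmetric polynomial $\sum_{\boldsymbol\beta}\boldsymbol z^{\boldsymbol\beta}$ (sum over the distinct permutations $\boldsymbol\beta$ of $\boldsymbol u$) and $a_{\boldsymbol u}=\det(z_j^{u_i})_{i,j=1}^n$. Put $$k_{\boldsymbol u}=\sqrt{\frac{(\lambda)_{\boldsymbol u}\,\boldsymbol\alpha!}{\boldsymbol u!\,n!}},\qquad \gamma_{\boldsymbol u}=\sqrt{\frac{(\lambda)_{\boldsymbol u}}{\boldsymbol u!\,n!}},$$ where $(\lambda)_{\boldsymbol u}=\prod_j\lambda(\lambda+1)\cdots(\lambda+u_j-1)$, $\boldsymbol u!=\prod_j u_j!$, and $\boldsymbol\alpha!$ is the product of the factorials of the multiplicities of the distinct entries of $\boldsymbol u$. Then the following hold. 1. For $1\le k\le n$ there is $r_k\le\binom nk$ such that $(G^{(k)}_{\rm sym},r_k)$ is a generalized directed semi-tree. For $\boldsymbol u\in\mathcal P_n^{\rm(sym)}$ one has $s_km_{\boldsymbol u}=\sum_{\boldsymbol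 v\in\mathcal I^{(k)}_{\boldsymbol u}}c^{(k)}_{\boldsymbol u,\boldsymbol v}m_{\boldsymbol v}$ with positive rational numbers $c^{(k)}_{\boldsymbol u,\boldsymbol v}$ (the coefficient of $\boldsymbol z^{\boldsymbol v}$ in $s_km_{\boldsymbol u}$). The multiplications $M_{s_1},\dots,M_{s_n}$ are bounded operators on $\mathbb A^{(\lambda)}_{\rm sym}(\mathbb D^n)$. The weighted shift $\Lambda^{\rm(sym)}_k$ on $G^{(k)}_{\rm sym}$ with weight $\frac{k_{\boldsymbol u}}{k_{\boldsymbol v}}c^{(k)}_{\boldsymbol u,\boldsymbol v}$ on the edge $(\boldsymbol u,\boldsymbol v)$ is everywhere defined and bounded on $\ell^2(\mathcal P_n^{\rm(sym)})$, with $\Lambda_k^{\rm(sym)}\chi_{\boldsymbol u}=\sum_{\boldsymbol v\in\mathcal I_{\boldsymbol u}^{(k)}}\frac{k_{\boldsymbol u}}{k_{\boldsymbol v}}c^{(k)}_{\boldsymbol u,\boldsymbol v}\chi_{\boldsymbol v}$. There is a unitary $U^{\rm(sym)}:\ell^2(\mathcal P_n^{\rm(sym)})\to\mathbb A^{(\lambda)}_{\rm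 sym}(\mathbb D^n)$ with $U^{\rm(sym)}\chi_{\boldsymbol u}=k_{\boldsymbol u}m_{\boldsymbol u}$ for all $\boldsymbol u$ and $U^{\rm(sym)}\Lambda^{\rm(sym)}_k=M_{s_k}U^{\rm(sym)}$ for $k=1,\dots,n$. 2. For $1\le k\le n$ there is $m_k\le\binom nk$ such that $(G^{(k)}_{\rm anti},m_k)$ is a generalized directed semi-tree. The multiplications $M_{s_1},\dots,M_{s_n}$ are bounded operators on $\mathbb A^{(\lambda)}_{\rm anti}(\mathbb D^n)$. The weighted shift $\Lambda^{\rm(anti)}_k$ on $G^{(k)}_{\rm anti}$ with weight $\frac{\gamma_{\boldsymbol u}}{\gamma_{\boldsymbol v}}$ on the edge $(\boldsymbol u,\boldsymbol v)$ is everywhere defined and bounded on $\ell^2(\mathcal P_n^{\rm(anti)})$, with $\Lambda_k^{\rm(anti)}\chi_{\boldsymbol u}=\sum_{\boldsymbol v\in\mathcal I_{\boldsymbol u}^{(k)}\cap\mathcal P_n^{\rm(anti)}}\frac{\gamma_{\boldsymbol u}}{\gamma_{\boldsymbol v}}\chi_{\boldsymbol v}$. There is a unitary $U^{\rm(anti)}:\ell^2(\mathcal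 P_n^{\rm(anti)})\to\mathbb A^{(\lambda)}_{\rm anti}(\mathbb D^n)$ with $U^{\rm(anti)}\chi_{\boldsymbol u}=\gamma_{\boldsymbol u}a_{\boldsymbol u}$ for all $\boldsymbol u$ and $U^{\rm(anti)}\Lambda^{\rm(anti)}_k=M_{s_k}U^{\rm(anti)}$ for $k=1,\dots,n$. -/

import Mathlib

open Complex
open scoped ComplexOrder ComplexConjugate Nat lp

noncomputable section

namespace SemiTree

/-! ## Directed graphs and generalized directed semi-trees -/

section Graph

variable {V : Type*}

/-- The children of a vertex. -/
def children (G : Digraph V) (u : V) : Set V := {v | G.Adj u v}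

/-- The parents of a vertex. -/
def parents (G : Digraph V) (v : V) : Set V := {u | G.Adj u v}

/-- A circuit is a finite sequence of at least two distinct vertices `v 0, …, v (m + 1)` with an
edge from each to the next one and from the last one to the first one (the addition of
`Fin (m + 2)` is cyclic). -/
def HasCircuit (G : Digraph V) : Prop :=
  ∃ (m : ℕ) (v : Fin (m + 2) → V), Function.Injective v ∧ ∀ j, G.Adj (v j) (v (j + 1))

/-- `(G, m)` is a generalized directed semi-tree. The type `Quot G.Adj` is the
quotient of the vertex set by the equivalence relation generated by the edges, that is, the set of
connected components. -/
structure IsGeneralizedDirectedSemiTree (G : Digraph V) (m : ℕ) : Prop where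
  nonempty : Nonempty V
  loopless : ∀ v, ¬ G.Adj v v
  no_circuit : ¬ HasCircuit G
  countable_components : Countable (Quot G.Adj)
  isLeast : IsLeast {l : ℕ | ∀ u v : V, u ≠ v → (children G u ∩ children G v).encard ≤ l} m

/-! ## Weighted shifts -/

theorem summable_weight_mul {ι : Type*} {s : Set ι} {a : s → ℂ}
    (ha : Summable fun u => ‖a u‖ ^ 2) (f : ℓ²(ι, ℂ)) : Summable fun u : s => a u * f u := by
  have hf : Summable fun u : s => ‖f u‖ ^ 2 := by
    have := (lp.memℓp f).summable (by norm_num)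
    have h2 := this.subtype (· ∈ s)
    simpa [Function.comp_def] using h2
  refine Summable.of_norm (Summable.of_nonneg_of_le (fun _ => norm_nonneg _) (fun u => ?_)
    (ha.add hf))
  rw [norm_mul]
  nlinarith [sq_nonneg (‖a u‖ - ‖f u‖), sq_nonneg ‖a u‖, sq_nonneg ‖f u‖]

/-- The formal weighted shift with weights `w u v` on the edges `(u, v)`: at `v` it is the sum over
the parents `u` of `v` (the sum is `0` at a root). -/
def shiftFun (G : Digraph V) (w : V → V → ℂ) (f : V → ℂ) (v : V) : ℂ :=
  ∑' u : parents G v, w u v * f u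

/-- The weighted shift on `G` with weights `w`, as an operator in `ℓ²(V)` with its maximal domain.
Only the values of `w` on the edges matter. -/
def weightedShift (G : Digraph V) (w : V → V → ℂ)
    (hw : ∀ v, Summable fun u : parents G v => ‖w u v‖ ^ 2) : ℓ²(V, ℂ) →ₗ.[ℂ] ℓ²(V, ℂ) where
  domain :=
    { carrier := {f | Memℓp (shiftFun G w f) 2}
      zero_mem' := by
        have : shiftFun G w (⇑(0 : ℓ²(V, ℂ))) = 0 := by
          ext v; simp [shiftFun]
        simp only [Set.mem_ofPred_eq, this]
        exact zero_memℓp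
      add_mem' := by
        intro f g hf hg
        have : shiftFun G w (⇑(f + g)) = shiftFun G w f + shiftFun G w g := by
          ext v
          simp only [shiftFun, lp.coeFn_add, Pi.add_apply, mul_add]
          exact (summable_weight_mul (hw v) f).tsum_add (summable_weight_mul (hw v) g)
        simp only [Set.mem_ofPred_eq, this] at hf hg ⊢
        exact hf.add hg
      smul_mem' := by
        intro c f hf
        have : shiftFun G w (⇑(c • f)) = c • shiftFun G w f := by
          ext v
          simp only [shiftFun, lp.coeFn_smul, Pi.smul_apply, smul_eq_mul, ← tsum_mul_left]
          exact tsum_congr fun u => by ring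
        simp only [Set.mem_ofPred_eq, this] at hf ⊢
        exact hf.const_smul c }
  toFun :=
    { toFun := fun f => ⟨shiftFun G w f.1, f.2⟩
      map_add' := by
        intro f g
        ext v
        simp only [shiftFun, lp.coeFn_add, Pi.add_apply, mul_add, Submodule.coe_add]
        exact (summable_weight_mul (hw v) f.1).tsum_add (summable_weight_mul (hw v) g.1)
      map_smul' := by
        intro c f
        ext v
        simp only [shiftFun, lp.coeFn_smul, Pi.smul_apply, smul_eq_mul, ← tsum_mul_left,
          RingHom.id_apply, Submodule.coe_smul]
        exact tsum_congr fun u => by ring }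

end Graph

/-! ## The weighted Bergman space of the polydisc -/

section Bergman

/-- The scalar kernel `∏ j, (1 - z_j conj w_j) ^ (-lam)` of the polydisc. -/
def kernelFun (n : ℕ) (lam : ℝ) : Matrix (Fin n → UnitDisc) (Fin n → UnitDisc) ℂ :=
  .of fun z w => ∏ j, (1 - (z j : ℂ) * conj (w j : ℂ)) ^ (-(lam : ℂ))

/-- The same kernel, with its values regarded as multiplication operators on `ℂ`. -/
def bergmanKernel (n : ℕ) (lam : ℝ) :
    Matrix (Fin n → UnitDisc) (Fin n → UnitDisc) (ℂ →L[ℂ] ℂ) :=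
  .of fun z w => kernelFun n lam z w • ContinuousLinearMap.id ℂ ℂ

theorem re_pos_aux (z w : UnitDisc) : ‖(z : ℂ) * conj (w : ℂ)‖ < 1 := by
  rw [norm_mul, RCLike.norm_conj]
  nlinarith [z.norm_lt_one, w.norm_lt_one, norm_nonneg (z : ℂ), norm_nonneg (w : ℂ)]

theorem hasSum_disc {lam : ℝ} (x : ℂ) (hx : ‖x‖ < 1) :
    HasSum (fun m : ℕ => ((Ring.choose (lam + m - 1) m : ℝ) : ℂ) * x ^ m)
      ((1 - x) ^ (-(lam : ℂ))) := by
  have h := (Complex.one_div_one_sub_cpow_hasFPowerSeriesOnBall_zero (lam : ℂ)).hasSum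
    (y := x) (by simpa [Metric.mem_eball, edist_zero_right, enorm_eq_nnnorm, ← NNReal.coe_lt_coe] using hx)
  simp only [zero_add, one_div, ← Complex.cpow_neg] at h
  have e : (fun m : ℕ => ((Ring.choose (lam + m - 1) m : ℝ) : ℂ) * x ^ m) = fun m : ℕ =>
      (FormalMultilinearSeries.ofScalars ℂ (fun m => Ring.choose ((lam : ℂ) + m - 1) m) m)
        fun _ => x := by
    ext m
    rw [FormalMultilinearSeries.ofScalars_apply_eq]
    simp [Complex.ofReal_choose]
  rw [e]
  exact h

theorem choose_nonneg {lam : ℝ} (h : 0 < lam) (m : ℕ) : 0 ≤ Ring.choose (lam + m - 1) m := by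
  have h1 : (m ! : ℝ) * Ring.choose (lam + m - 1) m = (ascPochhammer ℝ m).eval lam := by
    have h2 : Ring.choose (lam + m - 1) m = Ring.multichoose lam m := by
      rw [Ring.choose]; congr 1; ring
    rw [h2, ← nsmul_eq_mul, Ring.factorial_nsmul_multichoose_eq_ascPochhammer,
      Polynomial.ascPochhammer_smeval_eq_eval]
  have h3 : 0 < (ascPochhammer ℝ m).eval lam := ascPochhammer_pos m lam h
  have h4 : (0 : ℝ) < m ! := by exact_mod_cast m.factorial_pos
  by_contra hc
  nlinarith

theorem posSemidef_disc {lam : ℝ} (h : 0 < lam) :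
    (Matrix.of fun z w : UnitDisc => (1 - (z : ℂ) * conj (w : ℂ)) ^ (-(lam : ℂ))).PosSemidef := by
  constructor
  · ext z w
    simp only [Matrix.conjTranspose_apply, Matrix.of_apply]
    refine (hasSum_disc (lam := lam) _ (re_pos_aux w z)).star.unique ?_
    convert hasSum_disc (lam := lam) _ (re_pos_aux z w) using 2 with m
    simp [mul_comm]
  · intro x
    have key : HasSum (fun m : ℕ => ∑ i ∈ x.support, ∑ j ∈ x.support, star (x i) *
        (((Ring.choose (lam + m - 1) m : ℝ) : ℂ) * ((i : ℂ) * conj (j : ℂ)) ^ m) * x j)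
        (∑ i ∈ x.support, ∑ j ∈ x.support,
          star (x i) * (1 - (i : ℂ) * conj (j : ℂ)) ^ (-(lam : ℂ)) * x j) :=
      hasSum_sum fun i _ => hasSum_sum fun j _ =>
        ((hasSum_disc _ (re_pos_aux i j)).mul_left _).mul_right _
    simp only [Finsupp.sum, Matrix.of_apply]
    refine key.nonneg fun m => ?_
    have : ∑ i ∈ x.support, ∑ j ∈ x.support, star (x i) *
        (((Ring.choose (lam + m - 1) m : ℝ) : ℂ) * ((i : ℂ) * conj (j : ℂ)) ^ m) * x j =
        ((Ring.choose (lam + m - 1) m : ℝ) : ℂ) *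
          (star (∑ i ∈ x.support, x i * conj (i : ℂ) ^ m) *
            ∑ i ∈ x.support, x i * conj (i : ℂ) ^ m) := by
      rw [star_sum, Finset.sum_mul_sum, Finset.mul_sum]
      refine Finset.sum_congr rfl fun i _ => ?_
      rw [Finset.mul_sum]
      refine Finset.sum_congr rfl fun j _ => ?_
      simp [mul_pow]
      ring
    rw [this]
    exact mul_nonneg (by exact_mod_cast choose_nonneg h m) (star_mul_self_nonneg _)

theorem posSemidef_kernelFun (n : ℕ) {lam : ℝ} (h : 0 < lam) : (kernelFun n lam).PosSemidef := by
  have : ∀ s : Finset (Fin n), (Matrix.of fun z w : Fin n → UnitDisc =>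
      ∏ j ∈ s, (1 - (z j : ℂ) * conj (w j : ℂ)) ^ (-(lam : ℂ))).PosSemidef := by
    classical
    intro s
    induction s using Finset.induction_on with
    | empty =>
      constructor
      · ext z w; simp
      · intro x
        have : (x.sum fun i xi => x.sum fun j xj => star xi *
            (Matrix.of fun z w : Fin n → UnitDisc => ∏ j ∈ (∅ : Finset (Fin n)),
              (1 - (z j : ℂ) * conj (w j : ℂ)) ^ (-(lam : ℂ))) i j * xj) =
            star (∑ i ∈ x.support, x i) * ∑ i ∈ x.support, x i := by
          simp [Finsupp.sum, Finset.sum_mul_sum]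
        rw [this]
        exact star_mul_self_nonneg _
    | insert a s ha ih =>
      have h1 := ((posSemidef_disc h).submatrix (fun z : Fin n → UnitDisc => z a)).hadamard ih
      have h2 : (Matrix.of fun z w : Fin n → UnitDisc =>
          ∏ j ∈ insert a s, (1 - (z j : ℂ) * conj (w j : ℂ)) ^ (-(lam : ℂ))) =
          ((Matrix.of fun z w : UnitDisc => (1 - (z : ℂ) * conj (w : ℂ)) ^ (-(lam : ℂ))).submatrix
            (fun z : Fin n → UnitDisc => z a) (fun z => z a)).hadamard
          (Matrix.of fun z w : Fin n → UnitDisc =>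
            ∏ j ∈ s, (1 - (z j : ℂ) * conj (w j : ℂ)) ^ (-(lam : ℂ))) := by
        ext z w
        simp [Finset.prod_insert ha, Matrix.hadamard]
      rw [h2]
      exact h1
  exact this Finset.univ

theorem posSemidef_bergmanKernel (n : ℕ) {lam : ℝ} (h : 0 < lam) :
    (bergmanKernel n lam).PosSemidef := by
  have hk := posSemidef_kernelFun n h
  have ht := (RKHS.posSemidef_tfae (K := bergmanKernel n lam)).out 0 2
  refine ht.mpr ⟨?_, fun vv => ?_⟩
  · ext z w
    have h1 := hk.isHermitian.apply z w
    have h2 : star (ContinuousLinearMap.id ℂ ℂ) = ContinuousLinearMap.id ℂ ℂ :=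
      star_one (ℂ →L[ℂ] ℂ)
    simp only [bergmanKernel, Matrix.conjTranspose_apply, Matrix.of_apply, star_smul, h1, h2]
  · have h3 : (vv.sum fun x w => vv.sum fun x' w' => inner ℂ (bergmanKernel n lam x' x w) w') =
        vv.sum fun i xi => vv.sum fun j xj => star xi * kernelFun n lam i j * xj := by
      simp only [Finsupp.sum]
      refine Finset.sum_congr rfl fun i _ => Finset.sum_congr rfl fun j _ => ?_
      rw [← hk.isHermitian.apply i j]
      simp [bergmanKernel]
      ring
    rw [h3]
    exact (Complex.le_def.mp (hk.2 vv)).1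

instance (n : ℕ) (lam : ℝ) [h : Fact (0 < lam)] : Fact (bergmanKernel n lam).PosSemidef :=
  ⟨posSemidef_bergmanKernel n h.out⟩

/-- The weighted Bergman space on the polydisc `Fin n → UnitDisc`: the reproducing kernel Hilbert
space with kernel `∏ j, (1 - z_j conj w_j) ^ (-lam)`. Its elements coerce to functions. -/
abbrev Bergman (n : ℕ) (lam : ℝ) [Fact (0 < lam)] : Type :=
  RKHS.OfKernel (bergmanKernel n lam)

/-- The subspace of symmetric functions. -/
def symBergman (n : ℕ) (lam : ℝ) [Fact (0 < lam)] : Submodule ℂ (Bergman n lam) where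
  carrier := {f | ∀ (σ : Equiv.Perm (Fin n)) (z : Fin n → UnitDisc), f (z ∘ σ) = f z}
  zero_mem' := by simp
  add_mem' := by
    intro f g hf hg σ z
    simp [hf σ z, hg σ z]
  smul_mem' := by
    intro c f hf σ z
    simp [hf σ z]

/-- The subspace of antisymmetric functions. -/
def antiBergman (n : ℕ) (lam : ℝ) [Fact (0 < lam)] : Submodule ℂ (Bergman n lam) where
  carrier := {f | ∀ (σ : Equiv.Perm (Fin n)) (z : Fin n → UnitDisc),
    f (z ∘ σ) = ((Equiv.Perm.sign σ : ℤ) : ℂ) * f z}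
  zero_mem' := by simp
  add_mem' := by
    intro f g hf hg σ z
    simp [hf σ z, hg σ z, mul_add]
  smul_mem' := by
    intro c f hf σ z
    simp [hf σ z, mul_left_comm]

/-- The value at `z` of the elementary symmetric polynomial of degree `k`. -/
def elemSymm (n k : ℕ) (z : Fin n → UnitDisc) : ℂ :=
  MvPolynomial.aeval (fun i => (z i : ℂ)) (MvPolynomial.esymm (Fin n) ℚ k)

end Bergman

/-! ## Partitions, the graphs and the weights -/

section Combinatorics

variable {n : ℕ}

/-- Decreasing sequences `u_1 ≥ … ≥ u_n ≥ 0`. -/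
abbrev SymIndex (n : ℕ) : Type := {u : Fin n → ℕ // Antitone u}

/-- The sequences `v + (n - 1, n - 2, …, 0)` with `v_1 ≥ … ≥ v_n ≥ 0`. -/
abbrev AntiIndex (n : ℕ) : Type :=
  {u : Fin n → ℕ // ∃ v : Fin n → ℕ, Antitone v ∧ ∀ i, u i = v i + (n - 1 - (i : ℕ))}

open Classical in
/-- The decreasing `v` with `0 ≤ v_j - u_j ≤ 1` for all `j` and `∑ j, (v_j - u_j) = k`. -/
def verticalStrips (k : ℕ) (u : Fin n → ℕ) : Finset (Fin n → ℕ) :=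
  {v ∈ Finset.Icc u (u + 1) | Antitone v ∧ ∑ j, v j = ∑ j, u j + k}

/-- The graph on the index set of the symmetric space. -/
def symGraph (n k : ℕ) : Digraph (SymIndex n) where
  Adj u v := v.1 ∈ verticalStrips k u.1

/-- The graph on the index set of the antisymmetric space. -/
def antiGraph (n k : ℕ) : Digraph (AntiIndex n) where
  Adj u v := v.1 ∈ verticalStrips k u.1

/-- The product of the Pochhammer symbols `lam (lam + 1) ⋯ (lam + u_j - 1)`. -/
def pochhammerProd (lam : ℝ) (u : Fin n → ℕ) : ℝ := ∏ j, (ascPochhammer ℝ (u j)).eval lam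

/-- The product of the factorials of the numbers of occurrences of the values of `u`. -/
def multiplicityFactorial (u : Fin n → ℕ) : ℕ :=
  ∏ a ∈ Finset.univ.image u, (Finset.univ.filter fun i => u i = a).card !

/-- The monomial symmetric polynomial: the sum of the monomials with exponents in the orbit of `u`
under permutations, each taken once. -/
def monomialSymm (u : Fin n → ℕ) : MvPolynomial (Fin n) ℚ :=
  ∑ β ∈ Finset.univ.image (fun σ : Equiv.Perm (Fin n) => u ∘ σ),
    MvPolynomial.monomial (Finsupp.equivFunOnFinite.symm β) 1

/-- The alternant `det (z_j ^ u_i)`. -/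
def alternant (u : Fin n → ℕ) (z : Fin n → UnitDisc) : ℂ :=
  (Matrix.of fun i j => (z j : ℂ) ^ u i).det

/-- The coefficient of the monomial symmetric polynomial of `v` in the product of
`s_k` and the monomial symmetric polynomial of `u`. -/
def pieriCoeff (k : ℕ) (u v : Fin n → ℕ) : ℚ :=
  (MvPolynomial.esymm (Fin n) ℚ k * monomialSymm u).coeff (Finsupp.equivFunOnFinite.symm v)

/-- The inverse of the norm of the monomial symmetric polynomial of `u`. -/
def symNormalizer (lam : ℝ) (u : Fin n → ℕ) : ℝ :=
  √(pochhammerProd lam u * multiplicityFactorial u / ((∏ j, (u j)!) * n !))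

/-- The inverse of the norm of the alternant of `u`. -/
def antiNormalizer (lam : ℝ) (u : Fin n → ℕ) : ℝ :=
  √(pochhammerProd lam u / ((∏ j, (u j)!) * n !))

/-- The weight of the edge `(u, v)` in the symmetric case. -/
def symWeight (lam : ℝ) (k : ℕ) (u v : SymIndex n) : ℂ :=
  ((symNormalizer lam u.1 / symNormalizer lam v.1 * pieriCoeff k u.1 v.1 : ℝ) : ℂ)

/-- The weight of the edge `(u, v)` in the antisymmetric case. -/
def antiWeight (lam : ℝ) (u v : AntiIndex n) : ℂ :=
  ((antiNormalizer lam u.1 / antiNormalizer lam v.1 : ℝ) : ℂ)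

theorem finite_parents_sym (k : ℕ) (v : SymIndex n) : (parents (symGraph n k) v).Finite := by
  refine Set.Finite.subset ((Set.finite_Iic v.1).preimage Subtype.val_injective.injOn) ?_
  intro u hu
  simp only [parents, symGraph, verticalStrips, Set.mem_ofPred_eq, Finset.mem_filter,
    Finset.mem_Icc] at hu
  exact hu.1.1

theorem finite_parents_anti (k : ℕ) (v : AntiIndex n) : (parents (antiGraph n k) v).Finite := by
  refine Set.Finite.subset ((Set.finite_Iic v.1).preimage Subtype.val_injective.injOn) ?_
  intro u hu
  simp only [parents, antiGraph, verticalStrips, Set.mem_ofPred_eq, Finset.mem_filter,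
    Finset.mem_Icc] at hu
  exact hu.1.1

/-- The weighted shift on the graph of degree `k` in the symmetric case. -/
def symShift (n : ℕ) (lam : ℝ) (k : ℕ) : ℓ²(SymIndex n, ℂ) →ₗ.[ℂ] ℓ²(SymIndex n, ℂ) :=
  weightedShift (symGraph n k) (symWeight lam k) fun v =>
    haveI := (finite_parents_sym k v).to_subtype
    Summable.of_finite

/-- The weighted shift on the graph of degree `k` in the antisymmetric case. -/
def antiShift (n : ℕ) (lam : ℝ) (k : ℕ) : ℓ²(AntiIndex n, ℂ) →ₗ.[ℂ] ℓ²(AntiIndex n, ℂ) :=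
  weightedShift (antiGraph n k) (antiWeight lam) fun v =>
    haveI := (finite_parents_anti k v).to_subtype
    Summable.of_finite

end Combinatorics

end SemiTree

end

/-! The kernel is the sum of `kernelCoeff lam u * z ^ u * conj w ^ u` with positive coefficients
`(lam)_u / u!`, so the monomials are orthogonal in the Bergman space. This is made precise by the
vectors `feature z` of `ℓ²(Fin n → ℕ)`: they have the same Gram matrix as the kernel functions, and
their span is dense because Taylor coefficients are unique. Hence `exists_taylorIsometry`.
Multiplication by a coordinate is then the adjoint of a bounded weighted backward shift, so
polynomials act boundedly.

Both subspaces are treated together through a character `χ` of the permutation group with values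
`±1`. The signed orbit sums over decreasing `u`, with `χ` trivial on the stabilizer of `u`, form an
orthogonal basis of the coefficient families transforming by `χ` (`exists_equivariant_unitary`). For
`χ = 1` these are multiples of the monomial symmetric polynomials; for the sign they are the
alternants with `u` strictly decreasing. Counting stabilizers gives the two normalizing constants.

In these bases, multiplication by an elementary symmetric polynomial is given by the Pieri rules
`esymm_mul_monomialSymm` and `elemSymm_mul_alternant_eq_sum`. Transporting it to `ℓ²` by the unitary
gives a bounded operator whose matrix entries are the prescribed weights, and `exists_shift`
identifies it with the shift on its maximal domain. The graph statements hold because the sum of the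
entries grows along every edge and a vertex has at most `n.choose k` children. -/

namespace SemiTree

/-! ### Taylor expansion of the kernel and the `ℓ²` model of the Bergman space -/

section taylor

-- Induction on the number of variables: a product of two absolutely convergent series is a double
-- series, reindexed by splitting off the first coordinate. Summability of the norms is carried
-- along because the product of series needs it.
open Finset in
theorem summable_norm_and_hasSum_prod_pi {n : ℕ} (f : Fin n → ℕ → ℂ)
    (hf : ∀ i, Summable fun m => ‖f i m‖) :
    (Summable fun u : Fin n → ℕ => ‖∏ i, f i (u i)‖) ∧
      HasSum (fun u : Fin n → ℕ => ∏ i, f i (u i)) (∏ i, ∑' m, f i m) := by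
  induction n with
  | zero =>
    refine ⟨(hasSum_fintype _).summable, ?_⟩
    convert hasSum_fintype (fun u : Fin 0 → ℕ => ∏ i, f i (u i)) using 1
    simp
  | succ n ih =>
    obtain ⟨h1, h2⟩ := ih (fun i => f i.succ) fun i => hf i.succ
    have h3 := (hf 0).mul_norm h1
    have h4 := summable_mul_of_summable_norm (hf 0) h1
    have h5 := (hf 0).of_norm.hasSum.mul h2 h4
    constructor
    · rw [← (Fin.consEquiv fun _ : Fin (n + 1) => ℕ).summable_iff]
      simpa [Function.comp_def, Fin.prod_univ_succ, Fin.consEquiv] using h3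
    · rw [← (Fin.consEquiv fun _ : Fin (n + 1) => ℕ).hasSum_iff]
      simpa [Function.comp_def, Fin.prod_univ_succ, Fin.consEquiv] using h5

variable {n : ℕ}

/-- The Taylor coefficient of the kernel at the multi-index `u`. -/
noncomputable def kernelCoeff (lam : ℝ) (u : Fin n → ℕ) : ℝ :=
  ∏ j, Ring.choose (lam + u j - 1) (u j)

theorem factorial_mul_choose (lam : ℝ) (m : ℕ) :
    (m ! : ℝ) * Ring.choose (lam + m - 1) m = (ascPochhammer ℝ m).eval lam := by
  have h2 : Ring.choose (lam + m - 1) m = Ring.multichoose lam m := by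
    rw [Ring.choose]; congr 1; ring
  rw [h2, ← nsmul_eq_mul, Ring.factorial_nsmul_multichoose_eq_ascPochhammer,
    Polynomial.ascPochhammer_smeval_eq_eval]

theorem choose_eq_div (lam : ℝ) (m : ℕ) :
    Ring.choose (lam + m - 1) m = (ascPochhammer ℝ m).eval lam / m ! := by
  rw [← factorial_mul_choose, mul_div_cancel_left₀ _ (by exact_mod_cast m.factorial_ne_zero)]

theorem choose_pos_of_pos {lam : ℝ} (h : 0 < lam) (m : ℕ) : 0 < Ring.choose (lam + m - 1) m := by
  rw [choose_eq_div]
  exact div_pos (ascPochhammer_pos m lam h) (by exact_mod_cast m.factorial_pos)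

theorem kernelCoeff_eq (lam : ℝ) (u : Fin n → ℕ) :
    kernelCoeff lam u = pochhammerProd lam u / ∏ j, (u j)! := by
  simp only [kernelCoeff, choose_eq_div, Finset.prod_div_distrib, pochhammerProd, Nat.cast_prod]

theorem kernelCoeff_pos {lam : ℝ} (h : 0 < lam) (u : Fin n → ℕ) : 0 < kernelCoeff lam u :=
  Finset.prod_pos fun _ _ => choose_pos_of_pos h _

theorem kernelCoeff_comp_perm (lam : ℝ) (u : Fin n → ℕ) (σ : Equiv.Perm (Fin n)) :
    kernelCoeff lam (u ∘ σ) = kernelCoeff lam u :=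
  Equiv.prod_comp σ fun j => Ring.choose (lam + u j - 1) (u j)

theorem summable_and_hasSum_kernel {lam : ℝ} (x : Fin n → ℂ) (hx : ∀ i, ‖x i‖ < 1) :
    (Summable fun u : Fin n → ℕ => ‖(kernelCoeff lam u : ℂ) * ∏ i, x i ^ u i‖) ∧
      HasSum (fun u : Fin n → ℕ => (kernelCoeff lam u : ℂ) * ∏ i, x i ^ u i)
        (∏ i, (1 - x i) ^ (-(lam : ℂ))) := by
  have h := summable_norm_and_hasSum_prod_pi
    (fun (i : Fin n) (m : ℕ) => ((Ring.choose (lam + m - 1) m : ℝ) : ℂ) * x i ^ m)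
    fun i => (hasSum_disc (lam := lam) (x i) (hx i)).summable.norm
  simp only [Finset.prod_mul_distrib, (hasSum_disc (lam := lam) (x _) (hx _)).tsum_eq] at h
  simpa [kernelCoeff] using h

/-- The Taylor coefficients of the kernel function at `z` with respect to the orthonormal
monomials. -/
noncomputable def featureFun (lam : ℝ) (z : Fin n → UnitDisc) (u : Fin n → ℕ) : ℂ :=
  (√(kernelCoeff lam u) : ℂ) * ∏ j, conj (z j : ℂ) ^ u j

theorem conj_featureFun_mul {lam : ℝ} (h : 0 < lam) (z w : Fin n → UnitDisc) (u : Fin n → ℕ) :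
    conj (featureFun lam z u) * featureFun lam w u =
      (kernelCoeff lam u : ℂ) * ∏ j, ((z j : ℂ) * conj (w j : ℂ)) ^ u j := by
  have : (√(kernelCoeff lam u) : ℂ) * (√(kernelCoeff lam u) : ℂ) = kernelCoeff lam u := by
    rw [← ofReal_mul, Real.mul_self_sqrt (kernelCoeff_pos h u).le]
  rw [← this]
  simp only [featureFun, map_mul, map_prod, map_pow, conj_conj, conj_ofReal, mul_pow,
    Finset.prod_mul_distrib]
  ring

theorem memℓp_featureFun {lam : ℝ} (h : 0 < lam) (z : Fin n → UnitDisc) :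
    Memℓp (featureFun lam z) 2 := by
  refine memℓp_gen ?_
  convert (summable_and_hasSum_kernel (lam := lam) (fun i => (z i : ℂ) * conj (z i : ℂ))
    fun i => re_pos_aux (z i) (z i)).1 using 2 with u
  rw [← conj_featureFun_mul h, norm_mul, RCLike.norm_conj, ENNReal.toReal_ofNat, Real.rpow_ofNat,
    sq]

section feature

variable (lam : ℝ) [hl : Fact (0 < lam)]

/-- The feature vector of the kernel at `z`. -/
noncomputable def feature (z : Fin n → UnitDisc) : ℓ²(Fin n → ℕ, ℂ) :=
  ⟨featureFun lam z, memℓp_featureFun hl.out z⟩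

/-- Pairing with a feature vector evaluates a power series, so `f` is a family of coefficients with
respect to the monomials scaled by `√(kernelCoeff lam u)`. -/
theorem hasSum_inner_feature (z : Fin n → UnitDisc) (f : ℓ²(Fin n → ℕ, ℂ)) :
    HasSum (fun u => (√(kernelCoeff lam u) : ℂ) * f u * ∏ j, (z j : ℂ) ^ u j)
      (inner ℂ (feature lam z) f) := by
  refine (lp.hasSum_inner (𝕜 := ℂ) (feature lam z) f).congr_fun fun u => ?_
  simp [feature, featureFun]
  ring

theorem inner_feature_feature (z w : Fin n → UnitDisc) :
    inner ℂ (feature lam z) (feature lam w) = kernelFun n lam z w := by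
  refine (lp.hasSum_inner (𝕜 := ℂ) (feature lam z) (feature lam w)).unique ?_
  refine (summable_and_hasSum_kernel (lam := lam) (fun i => (z i : ℂ) * conj (w i : ℂ))
    fun i => re_pos_aux (z i) (w i)).2.congr_fun fun u => ?_
  rw [← conj_featureFun_mul hl.out, RCLike.inner_apply, mul_comm]
  rfl

/-- Uniqueness of the power series expansion of the zero function in one variable. -/
theorem coeff_eq_zero_of_hasSum_zero {b : ℕ → ℂ}
    (h : ∀ t : ℂ, ‖t‖ < 1 → HasSum (fun d => t ^ d * b d) 0) : b = 0 := by
  have h1 : HasFPowerSeriesAt (0 : ℂ → ℂ) (FormalMultilinearSeries.ofScalars ℂ b) 0 := by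
    rw [hasFPowerSeriesAt_iff]
    filter_upwards [Metric.ball_mem_nhds (0 : ℂ) one_pos] with t ht
    simpa [FormalMultilinearSeries.coeff_ofScalars] using h t (by simpa using ht)
  ext d
  have h2 := congrArg (fun p => FormalMultilinearSeries.coeff p d) h1.eq_zero
  rw [FormalMultilinearSeries.coeff_ofScalars] at h2
  exact h2

/-- Replacing `z` by `t z` and grouping by total degree gives a power series in `t`, so each
homogeneous part vanishes on the polydisc. Such a part is a polynomial vanishing on a product of
infinite sets, hence zero. -/
theorem coeff_eq_zero_of_hasSum_disc_zero {a : (Fin n → ℕ) → ℂ}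
    (h : ∀ z : Fin n → UnitDisc, HasSum (fun u => a u * ∏ j, (z j : ℂ) ^ u j) 0) : a = 0 := by
  have h1 : ∀ (z : Fin n → UnitDisc) (d : ℕ),
      ∑ u ∈ Finset.piAntidiag Finset.univ d, a u * ∏ j, (z j : ℂ) ^ u j = 0 := by
    intro z d
    refine congrFun (coeff_eq_zero_of_hasSum_zero (b := fun d =>
      ∑ u ∈ Finset.piAntidiag Finset.univ d, a u * ∏ j, (z j : ℂ) ^ u j) fun t ht => ?_) d
    have hz : ∀ j, ‖t * (z j : ℂ)‖ < 1 := fun j => by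
      rw [norm_mul]
      nlinarith [norm_nonneg t, norm_nonneg (z j : ℂ), (z j).norm_lt_one]
    have h2 := h fun j => UnitDisc.mk (t * z j) (hz j)
    rw [← (Equiv.sigmaFiberEquiv fun u : Fin n → ℕ => ∑ j, u j).hasSum_iff] at h2
    refine h2.sigma fun d => ?_
    have h3 : (fun c : {u : Fin n → ℕ // ∑ j, u j = d} => t ^ d * (a c * ∏ j, (z j : ℂ) ^ c.1 j)) =
        fun c => ((fun u => a u * ∏ j, ((UnitDisc.mk (t * z j) (hz j) : UnitDisc) : ℂ) ^ u j) ∘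
          Equiv.sigmaFiberEquiv fun u : Fin n → ℕ => ∑ j, u j) ⟨d, c⟩ := by
      ext ⟨c, hc⟩
      simp [Equiv.sigmaFiberEquiv, mul_pow, Finset.prod_mul_distrib, Finset.prod_pow_eq_pow_sum, hc]
      ring
    rw [← h3, Finset.mul_sum]
    have h4 := Finset.hasSum (Finset.piAntidiag Finset.univ d)
      (fun u : Fin n → ℕ => t ^ d * (a u * ∏ j, (z j : ℂ) ^ u j))
    let e : {u : Fin n → ℕ // ∑ j, u j = d} ≃ Finset.piAntidiag (Finset.univ : Finset (Fin n)) d :=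
      Equiv.subtypeEquivRight fun u => by simp
    exact (e.hasSum_iff (f := fun u : Finset.piAntidiag (Finset.univ : Finset (Fin n)) d =>
      t ^ d * (a u * ∏ j, (z j : ℂ) ^ u.1 j))).mpr h4
  ext u
  set d := ∑ j, u j
  let p : MvPolynomial (Fin n) ℂ := ∑ v ∈ Finset.piAntidiag Finset.univ d,
    MvPolynomial.monomial (Finsupp.equivFunOnFinite.symm v) (a v)
  have hp : p = 0 := by
    refine MvPolynomial.funext_set (fun _ => Metric.ball (0 : ℂ) 1)
      (fun _ => infinite_of_mem_nhds 0 (Metric.ball_mem_nhds 0 one_pos)) fun x hx => ?_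
    have hx' : ∀ i, ‖x i‖ < 1 := fun i => by simpa using hx i (Set.mem_univ i)
    simpa [p, MvPolynomial.eval_monomial, Finsupp.prod_fintype] using
      h1 (fun j => UnitDisc.mk (x j) (hx' j)) d
  have h5 := congrArg (MvPolynomial.coeff (Finsupp.equivFunOnFinite.symm u)) hp
  simpa [p, MvPolynomial.coeff_sum, MvPolynomial.coeff_monomial, d] using h5

theorem eq_zero_of_inner_feature {f : ℓ²(Fin n → ℕ, ℂ)}
    (h : ∀ z, inner ℂ (feature lam z) f = 0) : f = 0 := by
  have h1 := coeff_eq_zero_of_hasSum_disc_zero (a := fun u => (√(kernelCoeff lam u) : ℂ) * f u)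
    fun z => by rw [← h z]; exact hasSum_inner_feature lam z f
  ext u
  have h2 := congrFun h1 u
  have h3 : √(kernelCoeff lam u) ≠ 0 := (Real.sqrt_pos.mpr (kernelCoeff_pos hl.out u)).ne'
  simpa [h3] using h2

theorem dense_span_feature :
    (Submodule.span ℂ (Set.range (feature (n := n) lam))).topologicalClosure = ⊤ := by
  refine Submodule.topologicalClosure_eq_top_iff.mpr ((Submodule.eq_bot_iff _).mpr fun f hf => ?_)
  exact eq_zero_of_inner_feature lam fun z =>
    hf _ (Submodule.subset_span ⟨z, rfl⟩)

variable (n) in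
/-- The isometric isomorphism onto the weighted Bergman space which takes the standard basis to
the normalized monomials. -/
theorem exists_taylorIsometry : ∃ T : ℓ²(Fin n → ℕ, ℂ) ≃ₗᵢ[ℂ] Bergman n lam,
    ∀ f z, T f z = inner ℂ (feature lam z) f := by
  let κ : (Fin n → UnitDisc) → Bergman n lam := fun z => RKHS.kerFun (Bergman n lam) z 1
  have hκ : ∀ z w, inner ℂ (κ z) (κ w) = kernelFun n lam z w := fun z w => by
    simp only [κ, RKHS.kerFun_inner, RKHS.kerFun_apply, RKHS.OfKernel.kernel_ofKernel]
    simp [bergmanKernel]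
  -- Equal Gram matrices: a linear combination of kernel functions has the norm of the same
  -- combination of feature vectors. Both spans being dense, the correspondence extends to an
  -- isometric isomorphism.
  have hnorm : ∀ x : (Fin n → UnitDisc) →₀ ℂ,
      ‖Finsupp.linearCombination ℂ κ (LinearEquiv.refl ℂ _ x)‖ =
        ‖Finsupp.linearCombination ℂ (feature lam) x‖ := by
    intro x
    rw [LinearEquiv.refl_apply, @norm_eq_sqrt_re_inner ℂ, @norm_eq_sqrt_re_inner ℂ]
    simp only [Finsupp.linearCombination_apply, Finsupp.sum_inner, Finsupp.inner_sum,
      inner_smul_left, inner_smul_right, hκ, inner_feature_feature]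
  have hd1 : DenseRange (Finsupp.linearCombination ℂ (feature (n := n) lam)) := by
    have := dense_span_feature (n := n) lam
    rw [← Finsupp.range_linearCombination, ← Submodule.dense_iff_topologicalClosure_eq_top] at this
    exact this
  have hd2 : DenseRange (Finsupp.linearCombination ℂ κ) := by
    have := RKHS.kerFun_dense (Bergman n lam)
    have e : Submodule.span ℂ {RKHS.kerFun (Bergman n lam) x v | (x) (v)} =
        Submodule.span ℂ (Set.range κ) := by
      refine le_antisymm (Submodule.span_le.mpr ?_) (Submodule.span_mono ?_)
      · rintro _ ⟨x, v, rfl⟩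
        have : RKHS.kerFun (Bergman n lam) x v = v • κ x := by
          rw [← map_smul, smul_eq_mul, mul_one]
        rw [this]
        exact Submodule.smul_mem _ _ (Submodule.subset_span ⟨x, rfl⟩)
      · rintro _ ⟨x, rfl⟩
        exact ⟨x, 1, rfl⟩
    rw [e, ← Finsupp.range_linearCombination, ← Submodule.dense_iff_topologicalClosure_eq_top]
      at this
    exact this
  refine ⟨(LinearEquiv.refl ℂ _).extendOfIsometry _ _ hd1 hd2 hnorm, fun f z => ?_⟩
  set T := (LinearEquiv.refl ℂ _).extendOfIsometry _ _ hd1 hd2 hnorm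
  -- Since `T` takes feature vectors to kernel functions, the reproducing property turns the value
  -- `T f z` into an inner product with `feature lam z`.
  have h1 : T (feature lam z) = κ z := by
    have := LinearEquiv.extendOfIsometry_eq (LinearEquiv.refl ℂ _) _ _ hd1 hd2 hnorm
      (Finsupp.single z 1)
    simpa using this
  rw [← T.inner_map_map, h1]
  simp [κ]

end feature

end taylor

/-! ### Bounded multiplication by polynomials -/

section multipliers

/-- Composition with an injective map does not increase the `ℓ²` norm, and a bounded weight costs at
most the factor `C`. Weighted backward shifts are of this form. -/
theorem exists_weightedComp {ι : Type*} {e : ι → ι} (he : Function.Injective e) {d : ι → ℂ} {C : ℝ}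
    (hC : 0 ≤ C) (hd : ∀ i, ‖d i‖ ≤ C) :
    ∃ R : ℓ²(ι, ℂ) →L[ℂ] ℓ²(ι, ℂ), ∀ f i, R f i = d i * f (e i) := by
  have hs : ∀ f : ℓ²(ι, ℂ), Summable fun i => ‖f i‖ ^ 2 := fun f => by
    simpa using (lp.memℓp f).summable (by norm_num)
  have hle : ∀ (f : ℓ²(ι, ℂ)) i, ‖d i * f (e i)‖ ^ 2 ≤ C ^ 2 * ‖f (e i)‖ ^ 2 := fun f i => by
    rw [norm_mul, mul_pow]
    gcongr
    exact hd i
  have hm : ∀ f : ℓ²(ι, ℂ), Memℓp (fun i => d i * f (e i)) 2 := fun f => by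
    refine memℓp_gen ?_
    simpa using Summable.of_nonneg_of_le (fun i => sq_nonneg _) (hle f)
      (((hs f).comp_injective he).mul_left _)
  let R : ℓ²(ι, ℂ) →ₗ[ℂ] ℓ²(ι, ℂ) :=
    { toFun := fun f => ⟨fun i => d i * f (e i), hm f⟩
      map_add' := fun f g => by ext i; simp only [lp.coeFn_add, Pi.add_apply, mul_add]
      map_smul' := fun c f => by ext i; simp [mul_left_comm] }
  refine ⟨R.mkContinuous C fun f => ?_, fun f i => rfl⟩
  refine lp.norm_le_of_tsum_le (by norm_num) (by positivity) ?_
  have h1 : ∑' i, ‖f (e i)‖ ^ 2 ≤ ‖f‖ ^ 2 := by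
    have h2 := lp.norm_rpow_eq_tsum (p := 2) (by norm_num) f
    simp only [ENNReal.toReal_ofNat, Real.rpow_ofNat] at h2
    rw [h2]
    exact tsum_comp_le_tsum_of_inj (hs f) (fun _ => sq_nonneg _) he
  simp only [ENNReal.toReal_ofNat, Real.rpow_ofNat, mul_pow]
  calc ∑' i, ‖d i * f (e i)‖ ^ 2 ≤ ∑' i, C ^ 2 * ‖f (e i)‖ ^ 2 :=
        Summable.tsum_le_tsum (hle f) (by simpa using (hm f).summable (by norm_num))
          (((hs f).comp_injective he).mul_left _)
    _ = C ^ 2 * ∑' i, ‖f (e i)‖ ^ 2 := tsum_mul_left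
    _ ≤ C ^ 2 * ‖f‖ ^ 2 := by gcongr

variable {n : ℕ}

theorem kernelCoeff_add_single (lam : ℝ) (u : Fin n → ℕ) (j : Fin n) :
    kernelCoeff lam (u + Pi.single j 1) * (u j + 1) = kernelCoeff lam u * (lam + u j) := by
  have h1 : ∀ m : ℕ, Ring.choose (lam + (m + 1 : ℕ) - 1) (m + 1) * (m + 1 : ℝ) =
      Ring.choose (lam + m - 1) m * (lam + m) := fun m => by
    have : (m ! : ℝ) ≠ 0 := by exact_mod_cast m.factorial_ne_zero
    rw [choose_eq_div, choose_eq_div, ascPochhammer_succ_eval, Nat.factorial_succ]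
    push_cast
    field_simp
  rw [kernelCoeff, kernelCoeff, ← Finset.mul_prod_erase _ _ (Finset.mem_univ j),
    ← Finset.mul_prod_erase Finset.univ
      (fun j => Ring.choose (lam + u j - 1) (u j)) (Finset.mem_univ j)]
  have h2 : ∀ i ∈ Finset.univ.erase j,
      Ring.choose (lam + ((u + Pi.single j 1 : Fin n → ℕ) i : ℕ) - 1)
        ((u + Pi.single j 1 : Fin n → ℕ) i) = Ring.choose (lam + u i - 1) (u i) := fun i hi => by
    simp [Finset.ne_of_mem_erase hi]
  rw [Finset.prod_congr rfl h2]
  have h3 := h1 (u j)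
  simp only [Pi.add_apply, Pi.single_eq_same]
  linear_combination (∏ i ∈ Finset.univ.erase j, Ring.choose (lam + u i - 1) (u i)) * h3

variable (lam : ℝ) [hl : Fact (0 < lam)]

/-- Every feature vector is an eigenvector, with eigenvalue `conj (z j)`, of a weighted backward
shift `R`; therefore the adjoint of `R` is multiplication by `z j` on function values. -/
theorem exists_coordinate_multiplier (j : Fin n) :
    ∃ M : Bergman n lam →L[ℂ] Bergman n lam, ∀ F z, M F z = z j * F z := by
  obtain ⟨T, hT⟩ := exists_taylorIsometry n lam
  have hpos := fun u : Fin n → ℕ => kernelCoeff_pos (n := n) hl.out u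
  have hlam := hl.out
  -- The squared weight is `(u j + 1) / (lam + u j)`, by `kernelCoeff_add_single`. The bound `1 + 1
  -- / lam` serves small and large `lam` alike.
  obtain ⟨R, hR⟩ := exists_weightedComp (e := fun u : Fin n → ℕ => u + Pi.single j 1)
    (d := fun u => ((√(kernelCoeff lam u) / √(kernelCoeff lam (u + Pi.single j 1)) : ℝ) : ℂ))
    (C := √(1 + 1 / lam)) (add_left_injective _) (Real.sqrt_nonneg _) fun u => by
      rw [Complex.norm_real, Real.norm_eq_abs, abs_of_nonneg (by positivity),
        ← Real.sqrt_div (hpos u).le]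
      refine Real.sqrt_le_sqrt ?_
      rw [div_le_iff₀ (hpos _)]
      have h1 := kernelCoeff_add_single lam u j
      have h2 := hpos u
      have h4 : (0 : ℝ) < u j + 1 := by positivity
      refine le_of_mul_le_mul_right ?_ h4
      rw [mul_assoc, h1]
      have h3 : (1 + 1 / lam) * (lam + u j) = u j + 1 + (lam + u j / lam) := by
        field_simp
        ring
      have h5 : 0 ≤ kernelCoeff lam u * (lam + u j / lam) := by positivity
      nlinarith
  refine ⟨T.toContinuousLinearEquiv.toContinuousLinearMap ∘L R.adjoint ∘L
    T.symm.toContinuousLinearEquiv.toContinuousLinearMap, fun F z => ?_⟩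
  have h1 : R (feature lam z) = conj (z j : ℂ) • feature lam z := by
    ext u
    rw [hR]
    have h2 : √(kernelCoeff lam (u + Pi.single j 1)) ≠ 0 := (Real.sqrt_pos.mpr (hpos _)).ne'
    have h3 : ∏ i, conj (z i : ℂ) ^ (u + Pi.single j 1 : Fin n → ℕ) i =
        (∏ i, conj (z i : ℂ) ^ u i) * conj (z j : ℂ) := by
      simp only [Pi.add_apply, pow_add, Finset.prod_mul_distrib]
      congr 1
      rw [Finset.prod_eq_single j] <;> simp +contextual
    simp only [feature, featureFun, h3, lp.coeFn_smul, Pi.smul_apply, smul_eq_mul, ofReal_div]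
    field_simp
  have h2 : inner ℂ (feature lam z) (T.symm F) = F z := by
    rw [← hT, LinearIsometryEquiv.apply_symm_apply]
  change T (R.adjoint (T.symm F)) z = _
  rw [hT, ContinuousLinearMap.adjoint_inner_right, h1, inner_smul_left, h2, conj_conj]

theorem exists_polynomial_multiplier (p : MvPolynomial (Fin n) ℚ) :
    ∃ M : Bergman n lam →L[ℂ] Bergman n lam, ∀ F z,
      M F z = MvPolynomial.aeval (fun i => (z i : ℂ)) p * F z := by
  induction p using MvPolynomial.induction_on with
  | C a => exact ⟨(a : ℂ) • ContinuousLinearMap.id ℂ _, fun F z => by simp⟩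
  | add p q hp hq =>
    obtain ⟨M, hM⟩ := hp
    obtain ⟨N, hN⟩ := hq
    exact ⟨M + N, fun F z => by simp [hM, hN, add_mul]⟩
  | mul_X p j hp =>
    obtain ⟨M, hM⟩ := hp
    obtain ⟨N, hN⟩ := exists_coordinate_multiplier lam j
    exact ⟨M ∘L N, fun F z => by simp [hM, hN, mul_assoc]⟩

end multipliers

/-! ### Functions transforming by a character of the permutation group -/

section equivariant

variable {n : ℕ}

theorem exists_perm_antitone (u : Fin n → ℕ) : ∃ σ : Equiv.Perm (Fin n), Antitone (u ∘ σ) :=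
  ⟨Tuple.sort (OrderDual.toDual ∘ u), fun _ _ h => Tuple.monotone_sort (OrderDual.toDual ∘ u) h⟩

theorem eq_of_comp_perm_eq {u v : Fin n → ℕ} (hu : Antitone u) (hv : Antitone v)
    {σ : Equiv.Perm (Fin n)} (h : u ∘ σ = v) : u = v := by
  rw [← h]
  exact Tuple.unique_antitone (f := u) (σ := Equiv.refl _) (by simpa using hu) (by simpa [h] using hv)

theorem card_stabilizer (u : Fin n → ℕ) :
    (Finset.univ.filter fun σ : Equiv.Perm (Fin n) => u ∘ σ = u).card =
      multiplicityFactorial u := by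
  rw [← Fintype.card_subtype, DomMulAct.stabilizer_card', multiplicityFactorial]
  exact Finset.prod_congr rfl fun a _ => by rw [Fintype.card_subtype]

theorem multiplicityFactorial_pos (u : Fin n → ℕ) : 0 < multiplicityFactorial u :=
  Finset.prod_pos fun _ _ => Nat.factorial_pos _

theorem prod_pow_comp_perm (x : Fin n → ℂ) (u : Fin n → ℕ) (σ : Equiv.Perm (Fin n)) :
    ∏ j, x (σ j) ^ u (σ j) = ∏ j, x j ^ u j :=
  Equiv.prod_comp σ fun j => x j ^ u j

variable (χ : Equiv.Perm (Fin n) →* ℤˣ)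

/-- The signed sum of the standard basis vectors over the permutations of a multi-index. -/
noncomputable def orbitVector (u : Fin n → ℕ) : ℓ²(Fin n → ℕ, ℂ) :=
  ∑ σ : Equiv.Perm (Fin n), ((χ σ : ℤ) : ℂ) • lp.single 2 (u ∘ σ) (1 : ℂ)

/-- Coefficient families which transform under permutations by the character `χ`. -/
def IsEquivariant (f : (Fin n → ℕ) → ℂ) : Prop :=
  ∀ (σ : Equiv.Perm (Fin n)) u, f (u ∘ σ) = ((χ σ : ℤ) : ℂ) * f u

theorem character_mul_self (σ : Equiv.Perm (Fin n)) :
    ((χ σ : ℤ) : ℂ) * ((χ σ : ℤ) : ℂ) = 1 := by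
  rw [← Int.cast_mul, ← Units.val_mul, Int.units_mul_self]
  simp

theorem orbitVector_apply (u v : Fin n → ℕ) :
    orbitVector χ u v = ∑ σ : Equiv.Perm (Fin n), if u ∘ σ = v then ((χ σ : ℤ) : ℂ) else 0 := by
  simp only [orbitVector, lp.coeFn_sum, Finset.sum_apply, lp.coeFn_smul, Pi.smul_apply,
    lp.coeFn_single, Pi.single_apply, smul_eq_mul, mul_ite, mul_one, mul_zero, eq_comm (a := v)]

theorem isEquivariant_orbitVector (u : Fin n → ℕ) : IsEquivariant χ (orbitVector χ u) := by
  intro τ v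
  rw [orbitVector_apply, orbitVector_apply, Finset.mul_sum, ← Equiv.sum_comp (Equiv.mulRight τ)]
  refine Finset.sum_congr rfl fun σ _ => ?_
  have : u ∘ (σ * τ : Equiv.Perm (Fin n)) = v ∘ τ ↔ u ∘ σ = v := by
    rw [Equiv.Perm.coe_mul, ← Function.comp_assoc]
    exact τ.surjective.injective_comp_right.eq_iff
  simp only [Equiv.coe_mulRight, this, map_mul, Units.val_mul, Int.cast_mul, mul_ite, mul_zero]
  simp only [mul_comm]

/-- Each of the `n !` summands contributes `f u`, since the sign of `f (u ∘ σ)` cancels that of the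
basis vector. Thus an equivariant `f` orthogonal to the orbit vector of `u` vanishes at `u`. -/
theorem inner_orbitVector {f : ℓ²(Fin n → ℕ, ℂ)} (hf : IsEquivariant χ f) (u : Fin n → ℕ) :
    inner ℂ (orbitVector χ u) f = (n ! : ℂ) * f u := by
  simp only [orbitVector, sum_inner, inner_smul_left, lp.inner_single_left, hf _ u]
  have : ∀ σ : Equiv.Perm (Fin n), conj ((χ σ : ℤ) : ℂ) *
      inner ℂ (1 : ℂ) (((χ σ : ℤ) : ℂ) * f u) = f u := fun σ => by
    rw [RCLike.inner_apply, map_one, mul_one, map_intCast, ← mul_assoc,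
      character_mul_self, one_mul]
  rw [Finset.sum_congr rfl fun σ _ => this σ]
  simp [Fintype.card_perm]

variable (lam : ℝ) [hl : Fact (0 < lam)]

/-- Permuting the variables permutes the coefficients, because `kernelCoeff` is invariant;
uniqueness of the coefficients gives the converse. -/
theorem isEquivariant_iff {T : ℓ²(Fin n → ℕ, ℂ) ≃ₗᵢ[ℂ] Bergman n lam}
    (hT : ∀ f z, T f z = inner ℂ (feature lam z) f) (f : ℓ²(Fin n → ℕ, ℂ)) :
    IsEquivariant χ f ↔ ∀ (σ : Equiv.Perm (Fin n)) z, T f (z ∘ σ) = ((χ σ : ℤ) : ℂ) * T f z := by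
  have h1 : ∀ (σ : Equiv.Perm (Fin n)) (z : Fin n → UnitDisc), HasSum
      (fun u => (√(kernelCoeff lam u) : ℂ) * f (u ∘ σ) * ∏ j, (z j : ℂ) ^ u j) (T f (z ∘ σ)) := by
    intro σ z
    have h := hasSum_inner_feature lam (z ∘ σ) f
    rw [← hT, ← (Equiv.arrowCongr σ.symm (Equiv.refl ℕ)).hasSum_iff] at h
    refine h.congr_fun fun u => ?_
    have e : Equiv.arrowCongr σ.symm (Equiv.refl ℕ) u = u ∘ σ := rfl
    simp only [Function.comp_apply, e, kernelCoeff_comp_perm]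
    rw [prod_pow_comp_perm (fun j => (z j : ℂ))]
  have h2 : ∀ z : Fin n → UnitDisc, HasSum
      (fun u => (√(kernelCoeff lam u) : ℂ) * f u * ∏ j, (z j : ℂ) ^ u j) (T f z) := fun z => by
    rw [hT]; exact hasSum_inner_feature lam z f
  constructor
  · intro hf σ z
    refine (h1 σ z).unique (((h2 z).mul_left ((χ σ : ℤ) : ℂ)).congr_fun fun u => ?_)
    rw [hf σ u]
    ring
  · intro hf σ u
    have h3 := congrFun (coeff_eq_zero_of_hasSum_disc_zero
      (a := fun u => (√(kernelCoeff lam u) : ℂ) * (f (u ∘ σ) - ((χ σ : ℤ) : ℂ) * f u))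
      fun z => by
        have h4 := (h1 σ z).sub ((h2 z).mul_left ((χ σ : ℤ) : ℂ))
        rw [hf σ z, sub_self] at h4
        exact h4.congr_fun fun u => by ring) u
    have h5 : √(kernelCoeff lam u) ≠ 0 := (Real.sqrt_pos.mpr (kernelCoeff_pos hl.out u)).ne'
    simpa [h5, sub_eq_zero] using h3

theorem inner_feature_orbitVector (u : Fin n → ℕ) (z : Fin n → UnitDisc) :
    inner ℂ (feature lam z) (orbitVector χ u) = (√(kernelCoeff lam u) : ℂ) *
      ∑ σ : Equiv.Perm (Fin n), ((χ σ : ℤ) : ℂ) * ∏ j, (z j : ℂ) ^ u (σ j) := by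
  simp only [orbitVector, inner_sum, inner_smul_right, lp.inner_single_right, Finset.mul_sum]
  refine Finset.sum_congr rfl fun σ _ => ?_
  simp only [feature, featureFun, kernelCoeff_comp_perm, RCLike.inner_apply, map_mul, map_prod,
    map_pow, conj_conj, conj_ofReal, one_mul, Function.comp_apply]
  ring

/-- The unitary onto the space of functions transforming by the character `χ`. -/
theorem exists_equivariant_unitary {W : Submodule ℂ (Bergman n lam)}
    (hW : ∀ F, F ∈ W ↔ ∀ (σ : Equiv.Perm (Fin n)) z, F (z ∘ σ) = ((χ σ : ℤ) : ℂ) * F z)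
    {P : (Fin n → ℕ) → Prop} (hP : ∀ u, P u → Antitone u)
    (hstab : ∀ u, P u → ∀ σ : Equiv.Perm (Fin n), u ∘ σ = u → χ σ = 1)
    (hcompl : ∀ u, Antitone u → ¬ P u → ∃ σ : Equiv.Perm (Fin n), u ∘ σ = u ∧ χ σ = -1) :
    ∃ U : ℓ²({u // P u}, ℂ) ≃ₗᵢ[ℂ] W, ∀ (u : {u // P u}) (z : Fin n → UnitDisc),
      (U (lp.single 2 u 1) : Bergman n lam) z =
        (√(kernelCoeff lam u.1 / (n ! * multiplicityFactorial u.1)) : ℂ) *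
          ∑ σ : Equiv.Perm (Fin n), ((χ σ : ℤ) : ℂ) * ∏ j, (z j : ℂ) ^ u.1 (σ j) := by
  obtain ⟨T, hT⟩ := exists_taylorIsometry n lam
  have hmem : ∀ f, T f ∈ W ↔ IsEquivariant χ f := fun f => by
    rw [hW, isEquivariant_iff χ lam hT]
  let c : (Fin n → ℕ) → ℝ := fun u => n ! * multiplicityFactorial u
  have hc : ∀ u, 0 < c u := fun u => by
    have := multiplicityFactorial_pos u
    have := n.factorial_pos
    positivity
  let b : {u // P u} → W := fun u =>
    ⟨T (((1 / √(c u.1) : ℝ) : ℂ) • orbitVector χ u.1), by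
      rw [map_smul]
      exact W.smul_mem _ ((hmem _).mpr (isEquivariant_orbitVector χ _))⟩
  -- Point evaluations are continuous, so `W` is closed and hence complete, as a Hilbert basis
  -- requires.
  have hclosed : IsClosed (W : Set (Bergman n lam)) := by
    have : (W : Set (Bergman n lam)) = ⋂ (σ : Equiv.Perm (Fin n)) (z : Fin n → UnitDisc),
        {F | F (z ∘ σ) = ((χ σ : ℤ) : ℂ) * F z} := by
      ext F
      simp [hW]
    rw [this]
    refine isClosed_iInter fun σ => isClosed_iInter fun z => isClosed_eq ?_ ?_
    · exact RKHS.continuous_eval _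
    · exact continuous_const.mul (RKHS.continuous_eval _)
  have : CompleteSpace W := hclosed.completeSpace_coe
  -- On the diagonal only the stabilizer of `u` contributes, each element with sign `1` by `hstab`.
  -- Distinct decreasing indices lie in different orbits, so the other products vanish.
  have horb : ∀ u v : {u // P u}, inner ℂ (orbitVector χ u.1) (orbitVector χ v.1) =
      if u = v then (c u.1 : ℂ) else 0 := by
    intro u v
    rw [inner_orbitVector χ (isEquivariant_orbitVector χ _), orbitVector_apply]
    split_ifs with h
    · subst h
      have : ∀ σ : Equiv.Perm (Fin n), (if u.1 ∘ σ = u.1 then ((χ σ : ℤ) : ℂ) else 0) =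
          if u.1 ∘ σ = u.1 then 1 else 0 := fun σ => by
        split_ifs with h
        · simp [hstab _ u.2 σ h]
        · rfl
      simp only [this, Finset.sum_boole, card_stabilizer, c]
      push_cast
      rfl
    · rw [Finset.sum_eq_zero, mul_zero]
      intro σ _
      rw [if_neg]
      intro h2
      exact h (Subtype.ext (eq_of_comp_perm_eq (hP _ v.2) (hP _ u.2) h2).symm)
  have hb : Orthonormal ℂ b := by
    rw [orthonormal_iff_ite]
    intro u v
    rw [Submodule.coe_inner, T.inner_map_map, inner_smul_left, inner_smul_right, horb]
    split_ifs with h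
    · subst h
      rw [conj_ofReal, ← ofReal_mul, ← ofReal_mul]
      have := Real.mul_self_sqrt (hc u.1).le
      have h0 : √(c u.1) ≠ 0 := (Real.sqrt_pos.mpr (hc _)).ne'
      norm_cast
      field_simp
      rw [sq, this]
    · simp
  -- The coefficients of a vector orthogonal to all `b u` vanish at the indices in `P`. At the other
  -- decreasing indices a stabilizing `σ` with `χ σ = -1` makes the coefficient equal to its
  -- negative, and sorting reaches the remaining indices.
  have hperp : (Submodule.span ℂ (Set.range b))ᗮ = ⊥ := by
    refine (Submodule.eq_bot_iff _).mpr fun g hg => ?_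
    have hf : IsEquivariant χ (T.symm g) := by
      rw [← hmem, LinearIsometryEquiv.apply_symm_apply]
      exact g.2
    have h1 : ∀ u, P u → T.symm g u = 0 := fun u hu => by
      have h2 : inner ℂ (b ⟨u, hu⟩) g = 0 := hg _ (Submodule.subset_span ⟨_, rfl⟩)
      have h3 : (g : Bergman n lam) = T (T.symm g) := by simp
      rw [Submodule.coe_inner, h3, T.inner_map_map, inner_smul_left, inner_orbitVector χ hf] at h2
      have h0 : √(c u) ≠ 0 := (Real.sqrt_pos.mpr (hc _)).ne'
      simpa [h0, n.factorial_ne_zero] using h2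
    have h2 : ∀ u, Antitone u → T.symm g u = 0 := fun u hu => by
      by_cases h : P u
      · exact h1 u h
      · obtain ⟨σ, hσ, hχ⟩ := hcompl u hu h
        have h3 := hf σ u
        rw [hσ, hχ] at h3
        have h4 : T.symm (g : Bergman n lam) u = -T.symm (g : Bergman n lam) u := by
          simpa using h3
        exact self_eq_neg.mp h4
    have h3 : T.symm (g : Bergman n lam) = 0 := by
      ext u
      obtain ⟨σ, hσ⟩ := exists_perm_antitone u
      have h4 := hf σ u
      rw [h2 _ hσ] at h4
      have h5 : ((χ σ : ℤ) : ℂ) ≠ 0 := left_ne_zero_of_mul_eq_one (character_mul_self χ σ)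
      simpa [h5] using h4.symm
    have h4 : (g : Bergman n lam) = 0 := by simpa using h3
    exact_mod_cast h4
  let B := HilbertBasis.mkOfOrthogonalEqBot hb hperp
  refine ⟨B.repr.symm, fun u z => ?_⟩
  rw [B.repr_symm_single, HilbertBasis.coe_mkOfOrthogonalEqBot]
  change T _ z = _
  rw [hT, inner_smul_right, inner_feature_orbitVector, ← mul_assoc, ← ofReal_mul,
    Real.sqrt_div (kernelCoeff_pos hl.out _).le]
  congr 2
  simp only [c]
  ring

theorem elemSymm_comp_perm (k : ℕ) (σ : Equiv.Perm (Fin n)) (z : Fin n → UnitDisc) :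
    elemSymm n k (z ∘ σ) = elemSymm n k z := by
  rw [elemSymm, elemSymm]
  conv_rhs => rw [← MvPolynomial.esymm_isSymmetric (Fin n) ℚ k σ, MvPolynomial.aeval_rename]
  rfl

/-- Symmetric polynomials act by multiplication on the functions transforming by `χ`. -/
theorem exists_equivariant_multiplier {W : Submodule ℂ (Bergman n lam)}
    (hW : ∀ F, F ∈ W ↔ ∀ (σ : Equiv.Perm (Fin n)) z, F (z ∘ σ) = ((χ σ : ℤ) : ℂ) * F z)
    (k : ℕ) : ∃ M : W →L[ℂ] W, ∀ (F : W) z,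
      (M F : Bergman n lam) z = elemSymm n k z * (F : Bergman n lam) z := by
  obtain ⟨M, hM⟩ := exists_polynomial_multiplier (n := n) lam (MvPolynomial.esymm (Fin n) ℚ k)
  have hmem : ∀ F : W, (M ∘L W.subtypeL) F ∈ W := fun F => by
    rw [hW]
    intro σ z
    change M F (z ∘ σ) = _ * M F z
    rw [hM, hM, (hW _).mp F.2 σ z, ← elemSymm, ← elemSymm, elemSymm_comp_perm]
    ring
  exact ⟨(M ∘L W.subtypeL).codRestrict W hmem, fun F z => hM F z⟩

end equivariant

/-! ### Vertical strips, the graphs and the Pieri rule for monomial symmetric polynomials -/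

section combinatorics

variable {n : ℕ}

/-- The multi-index `u` with the entries at the places in `t` increased by one. -/
def addOnes (u : Fin n → ℕ) (t : Finset (Fin n)) (j : Fin n) : ℕ := u j + if j ∈ t then 1 else 0

theorem addOnes_injective (u : Fin n → ℕ) : Function.Injective (addOnes u) := by
  intro s t h
  ext j
  have := congrFun h j
  simp only [addOnes, add_right_inj] at this
  by_cases h1 : j ∈ s <;> by_cases h2 : j ∈ t <;> simp_all

theorem sum_addOnes (u : Fin n → ℕ) (t : Finset (Fin n)) :
    ∑ j, addOnes u t j = ∑ j, u j + t.card := by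
  simp [addOnes, Finset.sum_add_distrib]

theorem mem_verticalStrips {k : ℕ} {u v : Fin n → ℕ} :
    v ∈ verticalStrips k u ↔
      (u ≤ v ∧ v ≤ u + 1) ∧ Antitone v ∧ ∑ j, v j = ∑ j, u j + k := by
  simp [verticalStrips]

/-- The set `t` consists of the places where `v` differs from `u`. This matches strips with the
`k`-subsets indexing the terms of the elementary symmetric polynomial. -/
theorem mem_verticalStrips_iff {k : ℕ} {u v : Fin n → ℕ} :
    v ∈ verticalStrips k u ↔
      Antitone v ∧ ∃ t ∈ Finset.powersetCard k Finset.univ, addOnes u t = v := by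
  rw [mem_verticalStrips]
  constructor
  · rintro ⟨⟨h1, h2⟩, h3, h4⟩
    refine ⟨h3, Finset.univ.filter fun j => v j ≠ u j, ?_, ?_⟩
    all_goals
      have h5 : addOnes u (Finset.univ.filter fun j => v j ≠ u j) = v := by
        ext j
        have h6 : u j ≤ v j := h1 j
        have h7 : v j ≤ u j + 1 := h2 j
        simp only [addOnes, Finset.mem_filter, Finset.mem_univ, true_and]
        split_ifs <;> omega
    · have h6 := sum_addOnes u (Finset.univ.filter fun j => v j ≠ u j)
      rw [h5] at h6
      rw [Finset.mem_powersetCard]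
      exact ⟨Finset.subset_univ _, by omega⟩
    · exact h5
  · rintro ⟨h3, t, ht, rfl⟩
    refine ⟨⟨fun j => ?_, fun j => ?_⟩, h3, ?_⟩
    · simp [addOnes]
    · simp only [addOnes, Pi.add_apply, Pi.one_apply]
      split_ifs <;> omega
    · rw [sum_addOnes, (Finset.mem_powersetCard.mp ht).2]

theorem card_verticalStrips_le (k : ℕ) (u : Fin n → ℕ) :
    (verticalStrips k u).card ≤ n.choose k := by
  have h : verticalStrips k u ⊆ (Finset.powersetCard k Finset.univ).image (addOnes u) := fun v hv =>
    Finset.mem_image.mpr (mem_verticalStrips_iff.mp hv).2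
  refine (Finset.card_le_card h).trans (Finset.card_image_le.trans ?_)
  simp

/-- The graphs of vertical strips are generalized directed semi-trees. -/
theorem exists_isGeneralizedDirectedSemiTree {P : (Fin n → ℕ) → Prop} [hne : Nonempty {u // P u}]
    {k : ℕ} (hk : 0 < k) {G : Digraph {u // P u}}
    (hG : ∀ u v, G.Adj u v ↔ v.1 ∈ verticalStrips k u.1) :
    ∃ r ≤ n.choose k, IsGeneralizedDirectedSemiTree G r := by
  classical
  -- The sum of the entries is a strictly increasing height along edges; this excludes loops, and
  -- circuits too, since a vertex of maximal height on a circuit would have a higher successor.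
  have hlt : ∀ u v, G.Adj u v → ∑ j, u.1 j < ∑ j, v.1 j := fun u v h => by
    have := (mem_verticalStrips.mp ((hG u v).mp h)).2.2
    omega
  have hcard : ∀ u v : {u // P u}, u ≠ v →
      (children G u ∩ children G v).encard ≤ (n.choose k : ℕ) := fun u v _ => by
    have h1 : Subtype.val '' children G u ⊆ (verticalStrips k u.1 : Set (Fin n → ℕ)) := by
      rintro _ ⟨w, hw, rfl⟩
      exact (hG u w).mp hw
    calc (children G u ∩ children G v).encard ≤ (children G u).encard :=
          Set.encard_le_encard Set.inter_subset_left
      _ = (Subtype.val '' children G u).encard := (Subtype.val_injective.encard_image _).symm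
      _ ≤ (verticalStrips k u.1 : Set (Fin n → ℕ)).encard := Set.encard_le_encard h1
      _ ≤ (n.choose k : ℕ) := by
          rw [Set.encard_coe_eq_coe_finsetCard]
          exact_mod_cast card_verticalStrips_le k u.1
  have hex : ∃ l : ℕ, ∀ u v : {u // P u}, u ≠ v →
      (children G u ∩ children G v).encard ≤ l := ⟨_, hcard⟩
  refine ⟨Nat.find hex, Nat.find_min' hex hcard, ⟨hne, fun v h => (hlt v v h).false, ?_, ?_, ?_⟩⟩
  · rintro ⟨m, v, -, h⟩
    obtain ⟨j, hj⟩ := Finite.exists_max fun j => ∑ i, (v j).1 i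
    exact (hj (j + 1)).not_gt (hlt _ _ (h j))
  · infer_instance
  · exact ⟨Nat.find_spec hex, fun l hl => Nat.find_min' hex hl⟩

/-- Sorting preserves the entrywise order: `u j ≤ v j` says that more than `j` entries of `v` are at
least `u j`, and `σ.symm` carries the entries of `u` with this property to such entries of `v`. -/
theorem le_of_comp_perm_le {u v : Fin n → ℕ} (hu : Antitone u) (hv : Antitone v)
    {σ : Equiv.Perm (Fin n)} (h : u ∘ σ ≤ v) : u ≤ v := by
  intro j
  rw [← Tuple.lt_card_ge_iff_apply_ge_of_antitone hv]
  refine ((Tuple.lt_card_ge_iff_apply_ge_of_antitone hu).mpr le_rfl).trans_le ?_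
  refine Finset.card_le_card_of_injOn σ.symm (fun i hi => ?_) σ.symm.injective.injOn
  simp only [Finset.coe_filter, Finset.mem_univ, true_and, Set.mem_ofPred_eq] at hi ⊢
  exact hi.trans (by simpa using h (σ.symm i))

theorem le_comp_perm_of_le {u v : Fin n → ℕ} (hu : Antitone u) (hv : Antitone v)
    {σ : Equiv.Perm (Fin n)} (h : v ≤ u ∘ σ) : v ≤ u := by
  refine le_of_comp_perm_le (σ := σ.symm) hv hu fun i => ?_
  simpa using h (σ.symm i)

/-- Here `v` lies between `u ∘ σ` and `(u + 1) ∘ σ`, and sorting these bounds preserves both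
inequalities. So only strips occur in the Pieri rule. -/
theorem mem_verticalStrips_of_addOnes {k : ℕ} {u v : Fin n → ℕ} (hu : Antitone u) (hv : Antitone v)
    {σ : Equiv.Perm (Fin n)} {t : Finset (Fin n)} (ht : t ∈ Finset.powersetCard k Finset.univ)
    (h : addOnes (u ∘ σ) t = v) : v ∈ verticalStrips k u := by
  rw [mem_verticalStrips]
  subst h
  refine ⟨⟨le_of_comp_perm_le (σ := σ) hu hv fun i => ?_, ?_⟩, hv, ?_⟩
  · simp [addOnes]
  · refine le_comp_perm_of_le (σ := σ) (u := u + 1) (hu.add_const 1) hv fun i => ?_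
    simp only [addOnes, Function.comp_apply, Pi.add_apply, Pi.one_apply]
    split_ifs <;> omega
  · rw [sum_addOnes, (Finset.mem_powersetCard.mp ht).2]
    congr 1
    exact Equiv.sum_comp σ u

/-- The orbit of a multi-index under permutations. -/
def permOrbit (u : Fin n → ℕ) : Finset (Fin n → ℕ) :=
  Finset.univ.image fun σ : Equiv.Perm (Fin n) => u ∘ σ

theorem mem_permOrbit {u v : Fin n → ℕ} :
    v ∈ permOrbit u ↔ ∃ σ : Equiv.Perm (Fin n), u ∘ σ = v := by
  simp [permOrbit]

/-- The coefficient counts the ways of writing `v` as a rearrangement of `u` plus ones on a `k`-set;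
positivity and support are read off from this count. -/
theorem pieriCoeff_eq (k : ℕ) (u v : Fin n → ℕ) :
    pieriCoeff k u v = ∑ t ∈ Finset.powersetCard k Finset.univ, ∑ β ∈ permOrbit u,
      if addOnes β t = v then 1 else 0 := by
  rw [pieriCoeff, MvPolynomial.esymm_eq_sum_monomial, monomialSymm, Finset.sum_mul_sum,
    MvPolynomial.coeff_sum]
  refine Finset.sum_congr rfl fun t _ => ?_
  rw [MvPolynomial.coeff_sum]
  refine Finset.sum_congr rfl fun β _ => ?_
  rw [MvPolynomial.monomial_mul, MvPolynomial.coeff_monomial, mul_one]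
  congr 1
  rw [eq_iff_iff, DFunLike.ext_iff, funext_iff]
  refine forall_congr' fun j => ?_
  simp [addOnes, Finsupp.single_apply, add_comm]

theorem pieriCoeff_pos {k : ℕ} {u v : Fin n → ℕ} (h : v ∈ verticalStrips k u) :
    0 < pieriCoeff k u v := by
  obtain ⟨-, t, ht, rfl⟩ := mem_verticalStrips_iff.mp h
  have h0 : ∀ (t' : Finset (Fin n)) (β : Fin n → ℕ),
      (0 : ℚ) ≤ if addOnes β t' = addOnes u t then 1 else 0 := fun _ _ => by
    split_ifs <;> norm_num
  rw [pieriCoeff_eq]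
  refine Finset.sum_pos' (fun t' _ => Finset.sum_nonneg fun β _ => h0 t' β)
    ⟨t, ht, Finset.sum_pos' (fun β _ => h0 t β) ⟨u, mem_permOrbit.mpr ⟨1, rfl⟩, by simp⟩⟩

theorem mem_verticalStrips_of_pieriCoeff_ne_zero {k : ℕ} {u v : Fin n → ℕ} (hu : Antitone u)
    (hv : Antitone v) (h : pieriCoeff k u v ≠ 0) : v ∈ verticalStrips k u := by
  rw [pieriCoeff_eq] at h
  obtain ⟨t, ht, h⟩ := Finset.exists_ne_zero_of_sum_ne_zero h
  obtain ⟨β, hβ, h⟩ := Finset.exists_ne_zero_of_sum_ne_zero h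
  obtain ⟨σ, rfl⟩ := mem_permOrbit.mp hβ
  exact mem_verticalStrips_of_addOnes hu hv ht (by simpa using h)

theorem coeff_monomialSymm (u v : Fin n → ℕ) :
    (monomialSymm u).coeff (Finsupp.equivFunOnFinite.symm v) = if v ∈ permOrbit u then 1 else 0 := by
  simp [monomialSymm, MvPolynomial.coeff_sum, MvPolynomial.coeff_monomial, permOrbit]

theorem rename_monomialSymm (u : Fin n → ℕ) (σ : Equiv.Perm (Fin n)) :
    MvPolynomial.rename σ (monomialSymm u) = monomialSymm u := by
  have h : ∀ β : Fin n → ℕ, MvPolynomial.rename σ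
      (MvPolynomial.monomial (Finsupp.equivFunOnFinite.symm β) (1 : ℚ)) =
      MvPolynomial.monomial (Finsupp.equivFunOnFinite.symm (β ∘ σ.symm)) 1 := fun β => by
    have e : Finsupp.mapDomain σ (Finsupp.equivFunOnFinite.symm β) =
        Finsupp.equivFunOnFinite.symm (β ∘ σ.symm) := by
      ext j
      simp [Finsupp.mapDomain_equiv_apply]
    rw [MvPolynomial.rename_monomial, e]
  simp only [monomialSymm, map_sum, h]
  refine Finset.sum_nbij' (· ∘ σ.symm) (· ∘ σ) ?_ ?_ ?_ ?_ ?_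
  · intro β hβ
    obtain ⟨τ, rfl⟩ := mem_permOrbit.mp hβ
    exact mem_permOrbit.mpr ⟨τ * σ.symm, rfl⟩
  · intro β hβ
    obtain ⟨τ, rfl⟩ := mem_permOrbit.mp hβ
    exact mem_permOrbit.mpr ⟨τ * σ, rfl⟩
  · intro β _; ext j; simp
  · intro β _; ext j; simp
  · intro β _; rfl

theorem pieriCoeff_comp_perm (k : ℕ) (u v : Fin n → ℕ) (σ : Equiv.Perm (Fin n)) :
    pieriCoeff k u (v ∘ σ) = pieriCoeff k u v := by
  have h : MvPolynomial.rename σ (MvPolynomial.esymm (Fin n) ℚ k * monomialSymm u) =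
      MvPolynomial.esymm (Fin n) ℚ k * monomialSymm u := by
    rw [map_mul, MvPolynomial.rename_esymm, rename_monomialSymm]
  rw [pieriCoeff, pieriCoeff, ← MvPolynomial.coeff_rename_mapDomain σ σ.injective, h]
  congr 1
  ext j
  simp [Finsupp.mapDomain_equiv_apply]

/-- The Pieri rule for monomial symmetric polynomials. -/
theorem esymm_mul_monomialSymm (k : ℕ) {u : Fin n → ℕ} (hu : Antitone u) :
    MvPolynomial.esymm (Fin n) ℚ k * monomialSymm u =
      ∑ v ∈ verticalStrips k u, MvPolynomial.C (pieriCoeff k u v) * monomialSymm v := by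
  ext m
  obtain ⟨γ, rfl⟩ := Finsupp.equivFunOnFinite.symm.surjective m
  obtain ⟨σ, hσ⟩ := exists_perm_antitone γ
  -- An exponent `γ` lies in the orbit of exactly one decreasing index, its sorted form, so at most
  -- one summand on the right has a nonzero coefficient at `γ`.
  have h1 : ∀ v ∈ verticalStrips k u, γ ∈ permOrbit v ↔ γ ∘ σ = v := fun v hv => by
    rw [mem_permOrbit]
    constructor
    · rintro ⟨τ, rfl⟩
      exact (eq_of_comp_perm_eq (mem_verticalStrips.mp hv).2.1 hσ (σ := τ * σ) rfl).symm
    · rintro rfl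
      exact ⟨σ.symm, by ext j; simp⟩
  change pieriCoeff k u γ = _
  rw [MvPolynomial.coeff_sum, Finset.sum_congr rfl fun v hv => by
    rw [MvPolynomial.coeff_C_mul, coeff_monomialSymm, if_congr (h1 v hv) rfl rfl],
    ← pieriCoeff_comp_perm k u γ σ]
  simp only [mul_ite, mul_one, mul_zero, Finset.sum_ite_eq]
  split_ifs with h
  · rfl
  · by_contra h2
    exact h (mem_verticalStrips_of_pieriCoeff_ne_zero hu hσ h2)

/-- Orbit-stabilizer: each rearrangement of `u` comes from as many permutations as the stabilizer of
`u` has elements. -/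
theorem aeval_monomialSymm_mul (u : Fin n → ℕ) (x : Fin n → ℂ) :
    (multiplicityFactorial u : ℂ) * MvPolynomial.aeval x (monomialSymm u) =
      ∑ σ : Equiv.Perm (Fin n), ∏ j, x j ^ u (σ j) := by
  have h1 : ∀ β ∈ permOrbit u,
      (Finset.univ.filter fun σ : Equiv.Perm (Fin n) => u ∘ σ = β).card =
        multiplicityFactorial u := fun β hβ => by
    obtain ⟨τ, rfl⟩ := mem_permOrbit.mp hβ
    rw [← card_stabilizer]
    refine Finset.card_nbij' (· * τ⁻¹) (· * τ) ?_ ?_ ?_ ?_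
    · intro σ hσ
      simp only [Finset.coe_filter, Finset.mem_univ, true_and, Set.mem_ofPred_eq] at hσ ⊢
      rw [Equiv.Perm.coe_mul, ← Function.comp_assoc, hσ]
      ext j
      simp
    · intro σ hσ
      simp only [Finset.coe_filter, Finset.mem_univ, true_and, Set.mem_ofPred_eq] at hσ ⊢
      rw [Equiv.Perm.coe_mul, ← Function.comp_assoc, hσ]
    · intro σ _; simp
    · intro σ _; simp
  have h2 := Finset.sum_fiberwise_of_maps_to (s := Finset.univ) (t := permOrbit u)
    (g := fun σ : Equiv.Perm (Fin n) => u ∘ σ) (fun σ _ => mem_permOrbit.mpr ⟨σ, rfl⟩)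
    (fun σ => ∏ j, x j ^ u (σ j))
  rw [← h2, monomialSymm, map_sum, Finset.mul_sum]
  refine Finset.sum_congr rfl fun β hβ => ?_
  rw [Finset.sum_congr rfl (g := fun _ => ∏ j, x j ^ β j), Finset.sum_const, h1 β hβ, nsmul_eq_mul,
    MvPolynomial.aeval_monomial]
  · simp [Finsupp.prod_fintype]
  · intro σ hσ
    rw [← (Finset.mem_filter.mp hσ).2]
    rfl

end combinatorics

/-! ### From matrix entries to the weighted shift on its maximal domain -/

section shift

/-- The operator is `U⁻¹ M U`. As it is bounded, its coordinate at `v` is the inner product with the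
adjoint applied to the basis vector at `v`, which is the defining series of the shift. Hence every
formal image is square summable and the maximal domain is the whole space. -/
theorem exists_shift {I W : Type*} [DecidableEq I] [NormedAddCommGroup W] [InnerProductSpace ℂ W]
    (G : Digraph I) [DecidableRel G.Adj] (w : I → I → ℂ)
    (hw : ∀ v, Summable fun u : parents G v => ‖w u v‖ ^ 2)
    (U : ℓ²(I, ℂ) ≃ₗᵢ[ℂ] W) (M : W →L[ℂ] W) (S : I → Finset I) (hS : ∀ u v, v ∈ S u ↔ G.Adj u v)
    (hM : ∀ u, M (U (lp.single 2 u 1)) = ∑ v ∈ S u, w u v • U (lp.single 2 v 1)) :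
    ∃ Λ : ℓ²(I, ℂ) →L[ℂ] ℓ²(I, ℂ),
      ((Λ : ℓ²(I, ℂ) →ₗ[ℂ] ℓ²(I, ℂ)).toPMap ⊤) = weightedShift G w hw ∧
      (∀ u v, Λ (lp.single 2 u 1) v = if G.Adj u v then w u v else 0) ∧
      ∀ f, U (Λ f) = M (U f) := by
  let Λ : ℓ²(I, ℂ) →L[ℂ] ℓ²(I, ℂ) := U.symm.toContinuousLinearEquiv.toContinuousLinearMap ∘L M ∘L
    U.toContinuousLinearEquiv.toContinuousLinearMap
  have hΛ : ∀ f, Λ f = U.symm (M (U f)) := fun f => rfl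
  have h1 : ∀ u v, Λ (lp.single 2 u 1) v = if G.Adj u v then w u v else 0 := fun u v => by
    rw [hΛ, hM, map_sum]
    simp only [map_smul, LinearIsometryEquiv.symm_apply_apply, lp.coeFn_sum, Finset.sum_apply,
      lp.coeFn_smul, Pi.smul_apply, lp.coeFn_single, Pi.single_apply, smul_eq_mul, mul_ite,
      mul_one, mul_zero, Finset.sum_ite_eq, hS]
  have h2 : ∀ f, ⇑(Λ f) = shiftFun G w f := fun f => by
    ext v
    have h3 : Λ f v = inner ℂ (Λ.adjoint (lp.single 2 v 1)) f := by
      rw [ContinuousLinearMap.adjoint_inner_left, lp.inner_single_left]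
      simp
    have h4 : ∀ u, Λ.adjoint (lp.single 2 v 1) u = conj (Λ (lp.single 2 u 1) v) := fun u => by
      have h5 : Λ.adjoint (lp.single 2 v 1) u =
          inner ℂ (lp.single 2 u (1 : ℂ)) (Λ.adjoint (lp.single 2 v 1)) := by
        rw [lp.inner_single_left]
        simp
      rw [h5, ContinuousLinearMap.adjoint_inner_right, lp.inner_single_right]
      simp
    rw [h3, lp.inner_eq_tsum, shiftFun, tsum_subtype (parents G v) fun u => w u v * f u]
    refine tsum_congr fun u => ?_
    rw [h4, h1]
    by_cases h : G.Adj u v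
    · rw [if_pos h, Set.indicator_of_mem (show u ∈ parents G v from h)]
      simp [mul_comm]
    · rw [if_neg h, Set.indicator_of_notMem (show u ∉ parents G v from h)]
      simp
  refine ⟨Λ, ?_, h1, fun f => by simp [hΛ]⟩
  refine LinearPMap.ext ?_ ?_
  · symm
    rw [LinearMap.toPMap_domain, Submodule.eq_top_iff']
    intro f
    change Memℓp (shiftFun G w f) 2
    rw [← h2]
    exact lp.memℓp _
  · intro f g hfg
    apply lp.ext
    change ⇑(Λ f) = shiftFun G w f
    exact h2 f

end shift

/-! ### Strictly decreasing indices and the Pieri rule for alternants -/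

section alternants

variable {n : ℕ}

theorem exists_antitone_add_iff (u : Fin n → ℕ) :
    (∃ v : Fin n → ℕ, Antitone v ∧ ∀ i, u i = v i + (n - 1 - (i : ℕ))) ↔ StrictAnti u := by
  constructor
  · rintro ⟨v, hv, h⟩ i j hij
    have h1 := hv hij.le
    have h2 : (i : ℕ) < j := hij
    rw [h, h]
    omega
  · intro h
    obtain _ | m := n
    · exact ⟨u, Subsingleton.antitone _, fun i => i.elim0⟩
    -- A strict decrease loses at least one per step, so `u i + i` still decreases; comparison with
    -- the last place gives `m ≤ u i + i`, and the subtraction of `m` below is not truncated.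
    have h1 : Antitone fun i : Fin (m + 1) => u i + i := by
      rw [Fin.antitone_iff_succ_le]
      intro i
      have := h i.castSucc_lt_succ
      simp only [Fin.val_succ, Fin.val_castSucc]
      omega
    have h2 : ∀ i : Fin (m + 1), m ≤ u i + i := fun i => by
      have := h1 (Fin.le_last i)
      simp only [Fin.val_last] at this
      omega
    refine ⟨fun i => u i + i - m, fun i j hij => Nat.sub_le_sub_right (h1 hij) m, fun i => ?_⟩
    have := h2 i
    have := i.2
    dsimp only
    omega

theorem perm_eq_one_of_comp_eq {u : Fin n → ℕ} (hu : StrictAnti u) {σ : Equiv.Perm (Fin n)}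
    (h : u ∘ σ = u) : σ = 1 :=
  Equiv.ext fun i => hu.injective (congrFun h i)

theorem multiplicityFactorial_of_strictAnti {u : Fin n → ℕ} (hu : StrictAnti u) :
    multiplicityFactorial u = 1 := by
  rw [← card_stabilizer, Finset.card_eq_one]
  refine ⟨1, ?_⟩
  ext σ
  simp only [Finset.mem_filter, Finset.mem_univ, true_and, Finset.mem_singleton]
  exact ⟨perm_eq_one_of_comp_eq hu, fun h => by rw [h]; rfl⟩

theorem exists_lt_eq_of_not_strictAnti {u : Fin n → ℕ} (hu : Antitone u) (h : ¬ StrictAnti u) :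
    ∃ i j, i ≠ j ∧ u i = u j := by
  by_contra! h2
  exact h (hu.strictAnti_of_injective fun i j hij => by_contra fun hne => h2 i j hne hij)

theorem alternant_eq_sum (u : Fin n → ℕ) (z : Fin n → UnitDisc) :
    alternant u z = ∑ σ : Equiv.Perm (Fin n),
      ((Equiv.Perm.sign σ : ℤ) : ℂ) * ∏ j, (z j : ℂ) ^ u (σ j) := by
  simp [alternant, Matrix.det_apply']

theorem elemSymm_eq_sum (k : ℕ) (z : Fin n → UnitDisc) :
    elemSymm n k z = ∑ t ∈ Finset.powersetCard k Finset.univ, ∏ j ∈ t, (z j : ℂ) := by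
  simp [elemSymm, MvPolynomial.esymm]

/-- In the term of the determinant belonging to `σ`, the symmetric factor may be evaluated at `z ∘
σ.symm`; its monomial for `t` then raises the exponents `u` exactly at the places in `t`. -/
theorem elemSymm_mul_alternant (k : ℕ) (u : Fin n → ℕ) (z : Fin n → UnitDisc) :
    elemSymm n k z * alternant u z =
      ∑ t ∈ Finset.powersetCard k Finset.univ, alternant (addOnes u t) z := by
  simp only [alternant_eq_sum]
  rw [Finset.sum_comm, Finset.mul_sum]
  refine Finset.sum_congr rfl fun σ _ => ?_
  have h : ∀ t : Finset (Fin n), ∏ j, (z j : ℂ) ^ addOnes u t (σ j) =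
      (∏ j, (z j : ℂ) ^ u (σ j)) * ∏ j ∈ t, ((z ∘ σ.symm) j : ℂ) := fun t => by
    simp only [addOnes, pow_add, Finset.prod_mul_distrib]
    congr 1
    rw [← Equiv.prod_comp σ.symm]
    simp [Finset.prod_ite_mem, pow_ite]
  simp only [h, ← Finset.mul_sum]
  rw [← elemSymm_eq_sum, elemSymm_comp_perm]
  ring

open Classical in
/-- The Pieri rule for alternants. -/
theorem elemSymm_mul_alternant_eq_sum (k : ℕ) {u : Fin n → ℕ} (hu : StrictAnti u)
    (z : Fin n → UnitDisc) :
    elemSymm n k z * alternant u z =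
      ∑ v ∈ verticalStrips k u with StrictAnti v, alternant v z := by
  rw [elemSymm_mul_alternant, ← Finset.sum_image (f := fun v => alternant v z)
    ((addOnes_injective u).injOn)]
  symm
  refine Finset.sum_subset (fun v hv => ?_) fun v hv hv2 => ?_
  · exact Finset.mem_image.mpr (mem_verticalStrips_iff.mp (Finset.mem_filter.mp hv).1).2
  · obtain ⟨t, ht, rfl⟩ := Finset.mem_image.mp hv
    -- Adding zeros and ones to a strictly decreasing sequence can at worst create equal entries,
    -- and then the alternant has two equal rows. All surviving coefficients are `1`, as `addOnes u`
    -- is injective.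
    have h1 : Antitone (addOnes u t) := fun i j hij => by
      obtain rfl | hlt := hij.eq_or_lt
      · rfl
      · have := hu hlt
        simp only [addOnes]
        split_ifs <;> omega
    have h2 : ¬ StrictAnti (addOnes u t) := fun h3 => hv2 (Finset.mem_filter.mpr
      ⟨mem_verticalStrips_iff.mpr ⟨h1, t, ht, rfl⟩, h3⟩)
    obtain ⟨i, j, hij, h3⟩ := exists_lt_eq_of_not_strictAnti h1 h2
    exact Matrix.det_zero_of_row_eq hij (by ext l; simp [h3])

end alternants

/-! ### The normalizing constants and the two unitaries -/

section main

variable {n : ℕ} (lam : ℝ)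

/-- The sum over all permutations is `multiplicityFactorial u` times the monomial symmetric
polynomial; this factor is combined here with the inverse norm of the orbit sum. -/
theorem symNormalizer_eq (u : Fin n → ℕ) :
    symNormalizer lam u =
      √(kernelCoeff lam u / (n ! * multiplicityFactorial u)) * multiplicityFactorial u := by
  have h : (0 : ℝ) < multiplicityFactorial u := by exact_mod_cast multiplicityFactorial_pos u
  rw [symNormalizer, kernelCoeff_eq]
  nth_rw 3 [← Real.sqrt_sq h.le]
  rw [← Real.sqrt_mul' _ (sq_nonneg _)]
  congr 1
  field_simp

theorem antiNormalizer_eq {u : Fin n → ℕ} (hu : StrictAnti u) :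
    antiNormalizer lam u = √(kernelCoeff lam u / (n ! * multiplicityFactorial u)) := by
  rw [antiNormalizer, kernelCoeff_eq, multiplicityFactorial_of_strictAnti hu, Nat.cast_one, mul_one,
    div_div]

variable [hl : Fact (0 < lam)]

theorem symNormalizer_pos (u : Fin n → ℕ) : 0 < symNormalizer lam u := by
  have h : (0 : ℝ) < multiplicityFactorial u := by exact_mod_cast multiplicityFactorial_pos u
  have h1 : (0 : ℝ) < n ! := by exact_mod_cast n.factorial_pos
  have h2 := kernelCoeff_pos hl.out u
  rw [symNormalizer_eq]
  positivity

theorem antiNormalizer_pos {u : Fin n → ℕ} (hu : StrictAnti u) : 0 < antiNormalizer lam u := by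
  have h : (0 : ℝ) < multiplicityFactorial u := by exact_mod_cast multiplicityFactorial_pos u
  have h1 : (0 : ℝ) < n ! := by exact_mod_cast n.factorial_pos
  have h2 := kernelCoeff_pos hl.out u
  rw [antiNormalizer_eq lam hu]
  positivity

instance : Nonempty (SymIndex n) := ⟨⟨0, fun _ _ _ => le_rfl⟩⟩

instance : Nonempty (AntiIndex n) := ⟨⟨fun i => n - 1 - i, 0, fun _ _ _ => le_rfl, by simp⟩⟩

theorem AntiIndex.strictAnti (u : AntiIndex n) : StrictAnti u.1 :=
  (exists_antitone_add_iff _).mp u.2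

variable (n) in
theorem exists_symBergman_unitary : ∃ U : ℓ²(SymIndex n, ℂ) ≃ₗᵢ[ℂ] symBergman n lam,
    ∀ (u : SymIndex n) (z : Fin n → UnitDisc), (U (lp.single 2 u 1) : Bergman n lam) z =
      symNormalizer lam u.1 * MvPolynomial.aeval (fun i => (z i : ℂ)) (monomialSymm u.1) := by
  obtain ⟨U, hU⟩ := exists_equivariant_unitary (n := n) 1 lam (W := symBergman n lam)
    (P := Antitone) (fun F => by simp [symBergman]) (fun _ h => h) (fun _ _ _ _ => rfl)
    fun u h h' => absurd h h'
  refine ⟨U, fun u z => ?_⟩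
  rw [hU, symNormalizer_eq, ofReal_mul, mul_assoc, ofReal_natCast, aeval_monomialSymm_mul]
  simp

variable (n) in
theorem exists_antiBergman_unitary : ∃ U : ℓ²(AntiIndex n, ℂ) ≃ₗᵢ[ℂ] antiBergman n lam,
    ∀ (u : AntiIndex n) (z : Fin n → UnitDisc), (U (lp.single 2 u 1) : Bergman n lam) z =
      antiNormalizer lam u.1 * alternant u.1 z := by
  obtain ⟨U, hU⟩ := exists_equivariant_unitary (n := n) Equiv.Perm.sign lam
    (W := antiBergman n lam)
    (P := fun u => ∃ v : Fin n → ℕ, Antitone v ∧ ∀ i, u i = v i + (n - 1 - (i : ℕ)))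
    (fun F => Iff.rfl) (fun u h => ((exists_antitone_add_iff u).mp h).antitone)
    (fun u h σ hσ => by
      rw [perm_eq_one_of_comp_eq ((exists_antitone_add_iff u).mp h) hσ, map_one])
    fun u h h' => by
      rw [exists_antitone_add_iff] at h'
      obtain ⟨i, j, hij, h1⟩ := exists_lt_eq_of_not_strictAnti h h'
      -- A decreasing index that is not strictly decreasing has two equal entries; their
      -- transposition stabilizes it and is odd.
      refine ⟨Equiv.swap i j, ?_, Equiv.Perm.sign_swap hij⟩
      ext l
      simp only [Function.comp_apply, Equiv.swap_apply_def]
      split_ifs with h2 h3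
      · rw [h2, h1]
      · rw [h3, h1]
      · rfl
  refine ⟨U, fun u z => ?_⟩
  rw [hU, antiNormalizer_eq lam u.strictAnti, alternant_eq_sum]

theorem coe_sum_smul_apply {W : Submodule ℂ (Bergman n lam)} {I : Type*} (s : Finset I) (c : I → ℂ)
    (F : I → W) (z : Fin n → UnitDisc) :
    ((∑ i ∈ s, c i • F i : W) : Bergman n lam) z = ∑ i ∈ s, c i * (F i : Bergman n lam) z := by
  classical
  induction s using Finset.induction_on with
  | empty => simp
  | insert a s ha ih => simp [Finset.sum_insert ha, ← ih]

-- The Pieri rule is rewritten in the normalized basis; the quotient of normalizers in the weight is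
-- the resulting change of scale.
open Classical in
theorem exists_symShift {U : ℓ²(SymIndex n, ℂ) ≃ₗᵢ[ℂ] symBergman n lam}
    (hU : ∀ (u : SymIndex n) (z : Fin n → UnitDisc), (U (lp.single 2 u 1) : Bergman n lam) z =
      symNormalizer lam u.1 * MvPolynomial.aeval (fun i => (z i : ℂ)) (monomialSymm u.1))
    {k : ℕ} {M : symBergman n lam →L[ℂ] symBergman n lam}
    (hM : ∀ (F : symBergman n lam) z,
      (M F : Bergman n lam) z = elemSymm n k z * (F : Bergman n lam) z) :
    ∃ Λ : ℓ²(SymIndex n, ℂ) →L[ℂ] ℓ²(SymIndex n, ℂ),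
      ((Λ : ℓ²(SymIndex n, ℂ) →ₗ[ℂ] ℓ²(SymIndex n, ℂ)).toPMap ⊤) = symShift n lam k ∧
      (∀ u v : SymIndex n, Λ (lp.single 2 u 1) v =
        if v.1 ∈ verticalStrips k u.1 then symWeight lam k u v else 0) ∧
      ∀ f, U (Λ f) = M (U f) := by
  obtain ⟨Λ, h1, h2, h3⟩ := exists_shift (symGraph n k) (symWeight lam k)
    (fun v =>
      have := (finite_parents_sym k v).to_subtype
      Summable.of_finite) U M
    (fun u => (verticalStrips k u.1).subtype Antitone) (fun u v => by simp [symGraph]) fun u => by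
      refine Subtype.ext (RKHS.ext fun z => ?_)
      rw [coe_sum_smul_apply, hM, hU]
      have h4 := congrArg (MvPolynomial.aeval fun i => (z i : ℂ)) (esymm_mul_monomialSymm k u.2)
      rw [map_mul, ← elemSymm, map_sum] at h4
      rw [mul_left_comm, h4, Finset.mul_sum]
      have h5 := Finset.sum_subtype_of_mem (s := verticalStrips k u.1) (p := Antitone)
        (fun v => (symNormalizer lam u.1 : ℂ) * MvPolynomial.aeval (fun i => (z i : ℂ))
          (MvPolynomial.C (pieriCoeff k u.1 v) * monomialSymm v))
        fun v hv => (mem_verticalStrips.mp hv).2.1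
      rw [← h5]
      refine Finset.sum_congr rfl fun v _ => ?_
      have h6 : (symNormalizer lam v.1 : ℂ) ≠ 0 := by
        exact_mod_cast (symNormalizer_pos lam v.1).ne'
      rw [hU, symWeight, map_mul, MvPolynomial.aeval_C]
      simp only [ofReal_mul, ofReal_div, eq_ratCast, ofReal_ratCast]
      field_simp
  exact ⟨Λ, h1, fun u v => by rw [h2]; exact if_congr Iff.rfl rfl rfl, h3⟩

open Classical in
theorem exists_antiShift {U : ℓ²(AntiIndex n, ℂ) ≃ₗᵢ[ℂ] antiBergman n lam}
    (hU : ∀ (u : AntiIndex n) (z : Fin n → UnitDisc), (U (lp.single 2 u 1) : Bergman n lam) z =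
      antiNormalizer lam u.1 * alternant u.1 z)
    {k : ℕ} {M : antiBergman n lam →L[ℂ] antiBergman n lam}
    (hM : ∀ (F : antiBergman n lam) z,
      (M F : Bergman n lam) z = elemSymm n k z * (F : Bergman n lam) z) :
    ∃ Λ : ℓ²(AntiIndex n, ℂ) →L[ℂ] ℓ²(AntiIndex n, ℂ),
      ((Λ : ℓ²(AntiIndex n, ℂ) →ₗ[ℂ] ℓ²(AntiIndex n, ℂ)).toPMap ⊤) = antiShift n lam k ∧
      (∀ u v : AntiIndex n, Λ (lp.single 2 u 1) v =
        if v.1 ∈ verticalStrips k u.1 then antiWeight lam u v else 0) ∧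
      ∀ f, U (Λ f) = M (U f) := by
  obtain ⟨Λ, h1, h2, h3⟩ := exists_shift (antiGraph n k) (antiWeight lam)
    (fun v =>
      have := (finite_parents_anti k v).to_subtype
      Summable.of_finite) U M
    (fun u => (verticalStrips k u.1).subtype _) (fun u v => by
      rw [Finset.mem_subtype]
      rfl) fun u => by
      refine Subtype.ext (RKHS.ext fun z => ?_)
      rw [coe_sum_smul_apply, hM, hU, mul_left_comm, elemSymm_mul_alternant_eq_sum k u.strictAnti,
        Finset.mul_sum]
      simp only [← exists_antitone_add_iff]
      rw [← Finset.sum_subtype_eq_sum_filter]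
      refine Finset.sum_congr rfl fun v _ => ?_
      have h6 : (antiNormalizer lam v.1 : ℂ) ≠ 0 := by
        exact_mod_cast (antiNormalizer_pos lam (AntiIndex.strictAnti v)).ne'
      rw [hU, antiWeight, ofReal_div]
      field_simp
  exact ⟨Λ, h1, fun u v => by rw [h2]; exact if_congr Iff.rfl rfl rfl, h3⟩

end main

end SemiTree

open Classical SemiTree in
theorem mainTheorem2 (n : ℕ) (hn : 1 < n) (lam : ℝ) [Fact (0 < lam)] :
    -- the symmetric space
    ((∀ k : Fin n, ∃ r : ℕ, r ≤ n.choose (k + 1) ∧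
        IsGeneralizedDirectedSemiTree (symGraph n (k + 1)) r) ∧
      (∀ (k : Fin n) (u : SymIndex n),
        MvPolynomial.esymm (Fin n) ℚ (k + 1) * monomialSymm u.1 =
            ∑ v ∈ verticalStrips (k + 1) u.1,
              MvPolynomial.C (pieriCoeff (k + 1) u.1 v) * monomialSymm v ∧
          ∀ v ∈ verticalStrips (k + 1) u.1, 0 < pieriCoeff (k + 1) u.1 v) ∧
      ∃ (M : Fin n → symBergman n lam →L[ℂ] symBergman n lam)
        (Λ : Fin n → ℓ²(SymIndex n, ℂ) →L[ℂ] ℓ²(SymIndex n, ℂ))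
        (U : ℓ²(SymIndex n, ℂ) ≃ₗᵢ[ℂ] symBergman n lam),
        (∀ (k : Fin n) (f : symBergman n lam) (z : Fin n → Complex.UnitDisc),
          (M k f : Bergman n lam) z = elemSymm n (k + 1) z * (f : Bergman n lam) z) ∧
        (∀ k : Fin n, ((Λ k : ℓ²(SymIndex n, ℂ) →ₗ[ℂ] ℓ²(SymIndex n, ℂ)).toPMap ⊤) =
          symShift n lam (k + 1)) ∧
        (∀ (k : Fin n) (u v : SymIndex n), Λ k (lp.single 2 u 1) v =
          if v.1 ∈ verticalStrips (k + 1) u.1 then symWeight lam (k + 1) u v else 0) ∧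
        (∀ (u : SymIndex n) (z : Fin n → Complex.UnitDisc),
          (U (lp.single 2 u 1) : Bergman n lam) z =
            symNormalizer lam u.1 *
              MvPolynomial.aeval (fun i => (z i : ℂ)) (monomialSymm u.1)) ∧
        ∀ (k : Fin n) (f : ℓ²(SymIndex n, ℂ)), U (Λ k f) = M k (U f)) ∧
    -- the antisymmetric space
    ((∀ k : Fin n, ∃ m : ℕ, m ≤ n.choose (k + 1) ∧
        IsGeneralizedDirectedSemiTree (antiGraph n (k + 1)) m) ∧
      ∃ (M : Fin n → antiBergman n lam →L[ℂ] antiBergman n lam)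
        (Λ : Fin n → ℓ²(AntiIndex n, ℂ) →L[ℂ] ℓ²(AntiIndex n, ℂ))
        (U : ℓ²(AntiIndex n, ℂ) ≃ₗᵢ[ℂ] antiBergman n lam),
        (∀ (k : Fin n) (f : antiBergman n lam) (z : Fin n → Complex.UnitDisc),
          (M k f : Bergman n lam) z = elemSymm n (k + 1) z * (f : Bergman n lam) z) ∧
        (∀ k : Fin n, ((Λ k : ℓ²(AntiIndex n, ℂ) →ₗ[ℂ] ℓ²(AntiIndex n, ℂ)).toPMap ⊤) =
          antiShift n lam (k + 1)) ∧
        (∀ (k : Fin n) (u v : AntiIndex n), Λ k (lp.single 2 u 1) v =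
          if v.1 ∈ verticalStrips (k + 1) u.1 then antiWeight lam u v else 0) ∧
        (∀ (u : AntiIndex n) (z : Fin n → Complex.UnitDisc),
          (U (lp.single 2 u 1) : Bergman n lam) z = antiNormalizer lam u.1 * alternant u.1 z) ∧
        ∀ (k : Fin n) (f : ℓ²(AntiIndex n, ℂ)), U (Λ k f) = M k (U f)) := by
  refine ⟨⟨fun k => ?_, fun k u => ⟨esymm_mul_monomialSymm _ u.2, fun v hv => pieriCoeff_pos hv⟩, ?_⟩,
    fun k => ?_, ?_⟩
  -- The degree `k + 1` is positive; in degree zero every vertex would carry a loop.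
  · exact exists_isGeneralizedDirectedSemiTree k.1.succ_pos fun u v => Iff.rfl
  · obtain ⟨U, hU⟩ := exists_symBergman_unitary n lam
    choose M hM using fun k : Fin n => exists_equivariant_multiplier (n := n) 1 lam
      (W := symBergman n lam) (fun F => by simp [symBergman]) (k + 1)
    choose Λ h1 h2 h3 using fun k : Fin n => exists_symShift lam hU (hM k)
    exact ⟨M, Λ, U, hM, h1, fun k u v => by convert h2 k u v, hU, h3⟩
  · exact exists_isGeneralizedDirectedSemiTree k.1.succ_pos fun u v => Iff.rfl
  · obtain ⟨U, hU⟩ := exists_antiBergman_unitary n lam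
    choose M hM using fun k : Fin n => exists_equivariant_multiplier (n := n) Equiv.Perm.sign lam
      (W := antiBergman n lam) (fun F => Iff.rfl) (k + 1)
    choose Λ h1 h2 h3 using fun k : Fin n => exists_antiShift lam hU (hM k)
    exact ⟨M, Λ, U, hM, h1, fun k u v => by convert h2 k u v, hU, h3⟩
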